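/- **Corollary 1.5.** Let $\mathcal G$ be a graph of groups over a finite, non-empty, connected graph such that every vertex group is finitely generated, torsion-free and has non-trivial Floyd boundary, and every edge group is infinite cyclic. Then the fundamental group $\Gamma=\pi_1(\mathcal G)$ (taken with respect to any maximal tree of the graph) is a non-elementary convergence group. Here the terms have the following meaning. *Non-trivial Floyd boundary.* A Floyd function is a summable function $f:\mathbb N\to(0,\infty)$ for which there is $c>0$ with $c f(n)\le f(n+1)\le f(n)$ for all $n$. Given a group $G$, a finite generating set $S$ of $G$ and a Floyd function $f$, give each edge of the Cayley graph of $(G,S)$ at word distance $n$ from the identity the length $f(n)$. The Floyd boundary is the complement of the Cayley graph in its completion for the resulting path metric. The group $G$ has non-trivial Floyd boundary if, for some finite generating set and some Floyd function, this boundary has at least three points. *Non-elementary convergence group.* A group $\Gamma$ is a non-elementary convergence group if it acts by homeomorphisms on a compact metrizable space $M$ such that 1. every sequence of pairwise distinct elements of $\Gamma$ has a subsequence $(\gamma_n)$ for which there are points $\xi,\eta\in M$ such that for every compact $K\subseteq M\setminus\{\eta\}$ the sets $\gamma_nK$ converge uniformly to $\xi$; and 2. the limit set of $\Gamma$, that is,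 the set of all points $\xi$ that arise in this way as the attracting point of some sequence $(\gamma_n)$ of pairwise distinct elements of $\Gamma$, has at least three points. -/

import Mathlib

open Set Filter Topology
open scoped NNReal ENNReal Pointwise

/-! ### Convergence groups -/

/-- The sequence `γ` of elements of `Γ` collapses `M` with attracting point `ξ` and repelling
point `η`: for every compact `K ⊆ M \ {η}`, the sets `γ n • K` converge uniformly to `ξ`,
i.e. they eventually lie in any given neighbourhood of `ξ`. -/
def IsCollapsing {Γ M : Type*} [Group Γ] [TopologicalSpace M] [MulAction Γ M]
    (γ : ℕ → Γ) (ξ η : M) : Prop :=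
  ∀ K : Set M, IsCompact K → η ∉ K → ∀ U ∈ 𝓝 ξ, ∀ᶠ n in atTop, γ n • K ⊆ U

/-- The convergence property: every sequence of pairwise distinct elements of `Γ`
has a collapsing subsequence. -/
def IsConvergenceAction (Γ M : Type*) [Group Γ] [TopologicalSpace M] [MulAction Γ M] : Prop :=
  ∀ γ : ℕ → Γ, Function.Injective γ →
    ∃ σ : ℕ → ℕ, StrictMono σ ∧ ∃ ξ η : M, IsCollapsing (γ ∘ σ) ξ η

/-- The limit set of `Γ` in `M`: the attracting points of all collapsing sequences of pairwise
distinct elements of `Γ`. -/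
def convergenceLimitSet (Γ M : Type*) [Group Γ] [TopologicalSpace M] [MulAction Γ M] : Set M :=
  {ξ | ∃ γ : ℕ → Γ, Function.Injective γ ∧ ∃ η : M, IsCollapsing γ ξ η}

/-- `Γ` is a (non-elementary) convergence group: it acts by homeomorphisms on some compact
metrizable space `M` with the convergence property, and its limit set has at least three points.
(Without non-elementarity every group would qualify, acting on a point; every countable one
also acts with the convergence property on its own one-point compactification.)
A compact metrizable space has at most continuum many points, so `M : Type` is no
restriction. -/
def IsConvergenceGroup (Γ : Type*) [Group Γ] : Prop :=
  ∃ (M : Type) (_ : TopologicalSpace M) (_ : MulAction Γ M),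
    CompactSpace M ∧ TopologicalSpace.MetrizableSpace M ∧ ContinuousConstSMul Γ M ∧
      IsConvergenceAction Γ M ∧ 2 < (convergenceLimitSet Γ M).encard

/-! ### The Floyd boundary -/

/-- Floyd scaling functions: positive, summable, non-increasing, and decaying at most
geometrically from one integer to the next. -/
structure IsFloydFunction (f : ℕ → ℝ≥0) : Prop where
  pos : ∀ n, 0 < f n
  summable : Summable f
  antitone : ∀ n, f (n + 1) ≤ f n
  ratio : ∃ c : ℝ≥0, 0 < c ∧ ∀ n, c * f n ≤ f (n + 1)

/-- The Floyd length of an edge path in the Cayley graph of `G` with respect to `S`: an edge at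
word distance `n` from the identity has length `f n`. -/
noncomputable def floydLength {G : Type*} [Group G] (S : Set G) (f : ℕ → ℝ≥0) {g h : G}
    (p : (SimpleGraph.mulCayley S).Walk g h) : ℝ≥0∞ :=
  (p.darts.map fun d =>
    (f (min ((SimpleGraph.mulCayley S).dist 1 d.fst)
      ((SimpleGraph.mulCayley S).dist 1 d.snd)) : ℝ≥0∞)).sum

/-- A copy of the vertex set `G` of the Cayley graph, to carry the Floyd metric. -/
def FloydSpace {G : Type*} [Group G] (_S : Set G) (_f : ℕ → ℝ≥0) : Type _ := G

theorem floydLength_nil {G : Type*} [Group G] (S : Set G) (f : ℕ → ℝ≥0) (g : G) :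
    floydLength S f (SimpleGraph.Walk.nil : (SimpleGraph.mulCayley S).Walk g g) = 0 := by
  simp [floydLength]

theorem floydLength_append {G : Type*} [Group G] (S : Set G) (f : ℕ → ℝ≥0) {g h k : G}
    (p : (SimpleGraph.mulCayley S).Walk g h) (q : (SimpleGraph.mulCayley S).Walk h k) :
    floydLength S f (p.append q) = floydLength S f p + floydLength S f q := by
  simp [floydLength, SimpleGraph.Walk.darts_append]

theorem floydLength_reverse {G : Type*} [Group G] (S : Set G) (f : ℕ → ℝ≥0) {g h : G}
    (p : (SimpleGraph.mulCayley S).Walk g h) :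
    floydLength S f p.reverse = floydLength S f p := by
  simp only [floydLength, SimpleGraph.Walk.darts_reverse, List.map_reverse,
    List.sum_reverse, List.map_map]
  congr 1
  apply List.map_congr_left
  intro d _
  simp [min_comm]

/-- The Floyd metric: the infimum of the Floyd lengths of the edge paths joining two points. -/
noncomputable instance FloydSpace.instPseudoEMetricSpace {G : Type*} [Group G] (S : Set G)
    (f : ℕ → ℝ≥0) : PseudoEMetricSpace (FloydSpace S f) where
  edist g h := ⨅ p : (SimpleGraph.mulCayley S).Walk g h, floydLength S f p
  edist_self g := le_antisymm (iInf_le_of_le SimpleGraph.Walk.nil (floydLength_nil S f g).le) bot_le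
  edist_comm g h := le_antisymm
    (le_iInf fun p => iInf_le_of_le p.reverse (floydLength_reverse S f p).le)
    (le_iInf fun p => iInf_le_of_le p.reverse (floydLength_reverse S f p).le)
  edist_triangle g h k := ENNReal.le_iInf_add_iInf fun p q =>
    iInf_le_of_le (p.append q) (floydLength_append S f p q).le

/-- The Floyd boundary: the points which the metric completion adds to the Cayley graph. (The
Floyd lengths of edges tend to zero away from the identity, so completing the vertex set and
completing the whole geometric Cayley graph add the same points.) -/
def floydBoundary {G : Type*} [Group G] (S : Set G) (f : ℕ → ℝ≥0) :
    Set (UniformSpace.Completion (FloydSpace S f)) :=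
  (Set.range ((↑) : FloydSpace S f → UniformSpace.Completion (FloydSpace S f)))ᶜ

/-- `G` has non-trivial Floyd boundary: for some finite generating set and some Floyd function,
the Floyd boundary has at least three points. -/
def HasNontrivialFloydBoundary (G : Type*) [Group G] : Prop :=
  ∃ (S : Set G) (f : ℕ → ℝ≥0), S.Finite ∧ Subgroup.closure S = ⊤ ∧ IsFloydFunction f ∧
    2 < (floydBoundary S f).encard

/-! ### Graphs of groups -/

/-- A graph of groups with vertex set `V` and set `E` of geometric edges, each listed with one
chosen orientation; loops and multiple edges are allowed. -/
structure GraphOfGroups (V E : Type*) where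
  /-- origin of an edge -/
  src : E → V
  /-- terminus of an edge -/
  tgt : E → V
  /-- vertex groups -/
  vertexGroup : V → Type*
  /-- edge groups -/
  edgeGroup : E → Type*
  [vertexInst : ∀ v, Group (vertexGroup v)]
  [edgeInst : ∀ e, Group (edgeGroup e)]
  /-- inclusion of the edge group at the origin -/
  srcHom : ∀ e, edgeGroup e →* vertexGroup (src e)
  /-- inclusion of the edge group at the terminus -/
  tgtHom : ∀ e, edgeGroup e →* vertexGroup (tgt e)
  srcHom_injective : ∀ e, Function.Injective (srcHom e)
  tgtHom_injective : ∀ e, Function.Injective (tgtHom e)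

attribute [instance] GraphOfGroups.vertexInst GraphOfGroups.edgeInst

namespace GraphOfGroups

variable {V E : Type*}

/-- The set `T` of edges is (the edge set of) a maximal tree of the underlying graph: it contains
no loop and no two edges with the same endpoints, and the simple graph that it forms on the set of
all vertices is a tree. A maximal tree exists exactly if the underlying graph is connected and
non-empty. -/
def IsMaximalTree (𝒢 : GraphOfGroups V E) (T : Set E) : Prop :=
  (∀ e ∈ T, 𝒢.src e ≠ 𝒢.tgt e) ∧
  Set.InjOn (fun e => s(𝒢.src e, 𝒢.tgt e)) T ∧
  (SimpleGraph.fromEdgeSet ((fun e => s(𝒢.src e, 𝒢.tgt e)) '' T)).IsTree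

/-- The free product of all vertex groups and of the free group on the edges. -/
abbrev FreeProd (𝒢 : GraphOfGroups V E) : Type _ :=
  Monoid.Coprod (Monoid.CoprodI 𝒢.vertexGroup) (FreeGroup E)

/-- A vertex group element as an element of the free product. -/
def ofVertex (𝒢 : GraphOfGroups V E) (v : V) : 𝒢.vertexGroup v →* 𝒢.FreeProd :=
  Monoid.Coprod.inl.comp Monoid.CoprodI.of

/-- The stable letter of an edge. -/
def ofEdge (𝒢 : GraphOfGroups V E) (e : E) : 𝒢.FreeProd :=
  Monoid.Coprod.inr (FreeGroup.of e)

/-- The relators `t_e · h · t_e⁻¹ = h` (with `h` in the edge group of `e`, included at the terminus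
of `e` on the left and at the origin on the right), and `t_e = 1` for `e` in `T`. -/
def relators (𝒢 : GraphOfGroups V E) (T : Set E) : Set 𝒢.FreeProd :=
  {r | ∃ (e : E) (h : 𝒢.edgeGroup e),
      r = 𝒢.ofEdge e * 𝒢.ofVertex _ (𝒢.tgtHom e h) * (𝒢.ofEdge e)⁻¹ *
        (𝒢.ofVertex _ (𝒢.srcHom e h))⁻¹} ∪
    𝒢.ofEdge '' T

/-- The fundamental group of a graph of groups relative to a maximal tree `T`. -/
abbrev FundamentalGroup (𝒢 : GraphOfGroups V E) (T : Set E) : Type _ :=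
  𝒢.FreeProd ⧸ Subgroup.normalClosure (𝒢.relators T)

end GraphOfGroups

/-! ### Sequences -/

/-! `Γ` embeds in an iterated HNN extension of the free product of all vertex groups, with one
stable letter per edge conjugating generators of the two images of the edge group. The natural map
from this extension to `Γ` has a section: conjugate each vertex group by a potential on the maximal
tree with values in the kernel (`GraphOfGroups.exists_embedding`). Convergence actions restrict to
subgroups, so it suffices that the extension acts and that the image of one vertex group, which lies
in `Γ`, has infinite limit set.

A group acts on its Floyd compactification with the convergence property because geodesics far from
the identity are short in the Floyd metric (`floyd_isBasedConvergence`); three limit points force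
infinitely many. Torsion-freeness gives the edge generators infinite order. In a suitable factor of
the space they become parabolic: the fixed point pair of a loxodromic element and all its translates
are collapsed (`exists_pinching`). Fixed points of parabolic elements are perspective to the base
point (`HasPowerLimits.isPerspective`).

Free products and HNN extensions then act on trees of copies of the given space, realised as the
closure of the group in the product of all translates. The convergence property passes to this
closure as long as all projections of group elements to a copy are perspective to the base point
(`IsTreeProjection.isBasedConvergence`). In the free product the projections are orbit points of the
base point; in the HNN extension translates of the parabolic fixed points of the edge groups also
occur. Throughout, attracting and repelling points are read off from the orbit of one base point. -/

theorem exists_subseq_const_or_injective {α : Type*} (f : ℕ → α) :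
    ∃ σ : ℕ → ℕ, StrictMono σ ∧ ((∃ c, ∀ n, f (σ n) = c) ∨ Function.Injective (f ∘ σ)) := by
  by_cases h : ∃ c, ∃ᶠ n in atTop, f n = c
  · obtain ⟨c, hc⟩ := h
    obtain ⟨σ, hσ, h⟩ := extraction_of_frequently_atTop hc
    exact ⟨σ, hσ, Or.inl ⟨c, h⟩⟩
  · push Not at h
    obtain ⟨σ, -, hσ⟩ := exists_seq_of_forall_finset_exists (fun _ : ℕ => True)
      (fun m n => m < n ∧ f n ≠ f m) (fun s _ => by
        have h1 : ∀ᶠ n in atTop, ∀ x ∈ s, x < n ∧ f n ≠ f x := by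
          rw [Filter.eventually_all_finset]
          exact fun x _ => (eventually_gt_atTop x).and (h (f x))
        obtain ⟨n, hn⟩ := h1.exists
        exact ⟨n, trivial, hn⟩)
    refine ⟨σ, fun m n hmn => (hσ m n hmn).1, Or.inr fun m n hmn => ?_⟩
    by_contra hne
    rcases lt_or_gt_of_ne hne with hlt | hlt
    · exact (hσ m n hlt).2 hmn.symm
    · exact (hσ n m hlt).2 hmn

theorem exists_exit {P : ℕ → Prop} (h0 : P 0) (h1 : ∃ k, ¬ P k) : ∃ k, P k ∧ ¬ P (k + 1) := by
  by_contra h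
  push Not at h
  obtain ⟨k, hk⟩ := h1
  exact hk (Nat.rec h0 h k)

section Sequences

variable {M : Type*} [TopologicalSpace M] [CompactSpace M] [T2Space M] [SecondCountableTopology M]

theorem tendsto_of_forall_subseq {x : ℕ → M} {p : M}
    (h : ∀ σ : ℕ → ℕ, StrictMono σ → ∀ q, Tendsto (x ∘ σ) atTop (𝓝 q) → q = p) :
    Tendsto x atTop (𝓝 p) := by
  refine tendsto_of_subseq_tendsto fun ns hns => ?_
  obtain ⟨τ, hτ, hτ'⟩ := strictMono_subseq_of_tendsto_atTop hns
  obtain ⟨q, ρ, hρ, hq⟩ := CompactSpace.tendsto_subseq (x ∘ ns ∘ τ)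
  have := h (ns ∘ τ ∘ ρ) (hτ'.comp hρ) q hq
  exact ⟨τ ∘ ρ, this ▸ hq⟩

omit [CompactSpace M] in
theorem exists_diagonal [RegularSpace M] {s : ℕ → ℕ → M} {e : ℕ → M} {u : M}
    (hs : ∀ n, Tendsto (s n) atTop (𝓝 (e n))) (he : Tendsto e atTop (𝓝 u)) :
    ∃ k : ℕ → ℕ, Tendsto (fun n => s n (k n)) atTop (𝓝 u) := by
  let := TopologicalSpace.metrizableSpaceMetric M
  have : ∀ n, ∃ k, dist (s n k) (e n) < 1 / ((n : ℝ) + 1) := fun n =>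
    ((tendsto_iff_dist_tendsto_zero.1 (hs n)).eventually_lt_const (by positivity)).exists
  choose k hk using this
  refine ⟨k, he.congr_dist ?_⟩
  refine squeeze_zero (fun _ => dist_nonneg) (fun n => ?_) tendsto_one_div_add_atTop_nhds_zero_nat
  rw [dist_comm]
  exact (hk n).le

/-- If the paths `s n` lead from near `u` to near `v`, then they leave a neighbourhood of `u` at
times `k n` such that neither the last point inside accumulates at `v` nor the first point outside
accumulates at `u`. -/
theorem exists_exit_limits {s : ℕ → ℕ → M} {e : ℕ → M} {u v : M}
    (h0 : Tendsto (fun n => s n 0) atTop (𝓝 u))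
    (hs : ∀ n, Tendsto (s n) atTop (𝓝 (e n))) (he : Tendsto e atTop (𝓝 v)) (huv : u ≠ v) :
    ∃ σ : ℕ → ℕ, StrictMono σ ∧ ∃ (k : ℕ → ℕ) (b b' : M), b ≠ v ∧ b' ≠ u ∧
      Tendsto (fun n => s (σ n) (k n)) atTop (𝓝 b) ∧
      Tendsto (fun n => s (σ n) (k n + 1)) atTop (𝓝 b') := by
  -- Points of `U` cannot accumulate at `v`, because `V` is disjoint from `U`; points outside the
  -- open set `U` cannot accumulate at `u`.
  obtain ⟨U, V, hU, hV, huU, hvV, hd⟩ := t2_separation huv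
  have hev : ∀ᶠ n in atTop, ∃ k, s n k ∈ U ∧ s n (k + 1) ∉ U := by
    filter_upwards [h0.eventually (hU.mem_nhds huU), he.eventually (hV.mem_nhds hvV)] with n h1 h2
    refine exists_exit h1 ?_
    obtain ⟨k, hk⟩ := ((hs n).eventually (hV.mem_nhds h2)).exists
    exact ⟨k, fun h => hd.le_bot ⟨h, hk⟩⟩
  obtain ⟨σ₀, hσ₀, h⟩ := extraction_of_eventually_atTop hev
  choose k hk hk' using h
  obtain ⟨b, σ₁, hσ₁, hb⟩ := CompactSpace.tendsto_subseq fun n => s (σ₀ n) (k n)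
  obtain ⟨b', σ₂, hσ₂, hb'⟩ := CompactSpace.tendsto_subseq fun n => s (σ₀ (σ₁ n)) (k (σ₁ n) + 1)
  refine ⟨σ₀ ∘ σ₁ ∘ σ₂, hσ₀.comp (hσ₁.comp hσ₂), k ∘ σ₁ ∘ σ₂, b, b', ?_, ?_,
    hb.comp hσ₂.tendsto_atTop, hb'⟩
  · rintro rfl
    obtain ⟨n, hn⟩ := (hb.eventually (hV.mem_nhds hvV)).exists
    exact hd.le_bot ⟨hk _, hn⟩
  · rintro rfl
    obtain ⟨n, hn⟩ := (hb'.eventually (hU.mem_nhds huU)).exists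
    exact hk' _ hn

end Sequences

/-! ### Convergence actions with a base point -/

/-- The convergence property relative to a base point `o`: if `a n` is a sequence of distinct
elements for which `a n • o` tends to `ξ` and `(a n)⁻¹ • o` tends to `η`, then `a n` collapses
the complement of `η` to `ξ`. -/
def IsBasedConvergence (G : Type*) {M : Type*} [Group G] [TopologicalSpace M] [MulAction G M]
    (o : M) : Prop :=
  ∀ (a : ℕ → G) (x : ℕ → M) (x' y ξ η : M), Function.Injective a → Tendsto x atTop (𝓝 x') →
    Tendsto (fun n => a n • x n) atTop (𝓝 y) → Tendsto (fun n => a n • o) atTop (𝓝 ξ) →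
    Tendsto (fun n => (a n)⁻¹ • o) atTop (𝓝 η) → x' = η ∨ y = ξ

/-- The point `u` is perspective to `o`: no sequence of distinct elements of `G` separates the
images of `u` and `o`. -/
def IsPerspective (G : Type*) {M : Type*} [Group G] [TopologicalSpace M] [MulAction G M]
    (o u : M) : Prop :=
  ∀ (a : ℕ → G) (p ξ : M), Function.Injective a → Tendsto (fun n => a n • u) atTop (𝓝 p) →
    Tendsto (fun n => a n • o) atTop (𝓝 ξ) → p = ξ

/-- The element `z` has infinite order, its positive powers move `o` towards `d` and its negative
powers move `o` towards `c`. In a convergence action `z` is parabolic if `c = d` and loxodromic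
otherwise. -/
structure HasPowerLimits {G M : Type*} [Group G] [TopologicalSpace M] [MulAction G M]
    (z : G) (o c d : M) : Prop where
  injective : Function.Injective fun k : ℤ => z ^ k
  tendsto : Tendsto (fun k : ℕ => z ^ k • o) atTop (𝓝 d)
  tendsto_inv : Tendsto (fun k : ℕ => (z ^ k)⁻¹ • o) atTop (𝓝 c)

/-- The accumulation points of the orbit of `o` under a subset `H` of `G`. -/
def basedLimitSet {G M : Type*} [Group G] [TopologicalSpace M] [MulAction G M]
    (H : Set G) (o : M) : Set M :=
  {ξ | ∃ a : ℕ → G, Function.Injective a ∧ (∀ n, a n ∈ H) ∧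
    Tendsto (fun n => a n • o) atTop (𝓝 ξ)}

section Dynamics

variable {G M : Type*} [Group G] [TopologicalSpace M] [CompactSpace M] [T2Space M]
  [SecondCountableTopology M] [MulAction G M] {o : M}

omit [T2Space M] in
theorem exists_limits (o : M) (a : ℕ → G) : ∃ σ : ℕ → ℕ, StrictMono σ ∧ ∃ ξ η : M,
    Tendsto (fun n => a (σ n) • o) atTop (𝓝 ξ) ∧ Tendsto (fun n => (a (σ n))⁻¹ • o) atTop (𝓝 η) := by
  obtain ⟨ξ, σ, hσ, h1⟩ := CompactSpace.tendsto_subseq fun n => a n • o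
  obtain ⟨η, τ, hτ, h2⟩ := CompactSpace.tendsto_subseq fun n => (a (σ n))⁻¹ • o
  exact ⟨σ ∘ τ, hσ.comp hτ, ξ, η, h1.comp hτ.tendsto_atTop, h2⟩

theorem IsPerspective.tendsto {u : M} (hu : IsPerspective G o u) {a : ℕ → G}
    (ha : Function.Injective a) {ξ : M} (h : Tendsto (fun n => a n • o) atTop (𝓝 ξ)) :
    Tendsto (fun n => a n • u) atTop (𝓝 ξ) :=
  tendsto_of_forall_subseq fun σ hσ q hq =>
    hu (a ∘ σ) q ξ (ha.comp hσ.injective) hq (h.comp hσ.tendsto_atTop)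

theorem IsPerspective.eq {u v : M} (hu : IsPerspective G o u) (hv : IsPerspective G o v)
    {a : ℕ → G} (ha : Function.Injective a) {p q : M} (h : Tendsto (fun n => a n • u) atTop (𝓝 p))
    (h' : Tendsto (fun n => a n • v) atTop (𝓝 q)) : p = q := by
  obtain ⟨ξ, σ, hσ, h1⟩ := CompactSpace.tendsto_subseq fun n => a n • o
  have e := hu _ _ _ (ha.comp hσ.injective) (h.comp hσ.tendsto_atTop) h1
  have e' := hv _ _ _ (ha.comp hσ.injective) (h'.comp hσ.tendsto_atTop) h1
  rw [e, e']

variable [ContinuousConstSMul G M]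

namespace IsBasedConvergence

/-- The convergence property of `a n` settles every case but `g • o = η`. There it is applied to `a
n * g` and the point `g⁻¹ • o`, which exchanges the roles of the two orbits. -/
theorem isPerspective_smul_base (hG : IsBasedConvergence G o) (g : G) :
    IsPerspective G o (g • o) := by
  intro a p ξ ha hp hξ
  obtain ⟨η, σ, hσ, hη⟩ := CompactSpace.tendsto_subseq fun n => (a n)⁻¹ • o
  have ha' := ha.comp hσ.injective
  have hp' := hp.comp hσ.tendsto_atTop
  have hξ' := hξ.comp hσ.tendsto_atTop
  rcases hG (a ∘ σ) (fun _ => g • o) (g • o) p ξ η ha' tendsto_const_nhds hp' hξ' hη with h | h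
  · rcases hG (fun n => a (σ n) * g) (fun _ => g⁻¹ • o) (g⁻¹ • o) ξ p (g⁻¹ • η)
      ((mul_left_injective g).comp ha') tendsto_const_nhds (by simpa [mul_smul, Function.comp_def] using hξ')
      (by simpa [mul_smul, Function.comp_def] using hp') (by simpa [mul_smul, Function.comp_def] using hη.const_smul g⁻¹) with h1 | h1
    · have e : g • o = o := by rw [h]; exact (smul_left_cancel _ h1).symm
      rw [e] at hp
      exact tendsto_nhds_unique hp hξ
    · exact h1.symm
  · exact h

theorem tendsto_smul_base (hG : IsBasedConvergence G o) {a : ℕ → G} (ha : Function.Injective a)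
    {ξ : M} (h : Tendsto (fun n => a n • o) atTop (𝓝 ξ)) (g : G) :
    Tendsto (fun n => a n • g • o) atTop (𝓝 ξ) :=
  (hG.isPerspective_smul_base g).tendsto ha h

theorem smul_isPerspective (hG : IsBasedConvergence G o) {u : M} (hu : IsPerspective G o u) (g : G) :
    IsPerspective G o (g • u) := by
  intro a p ξ ha hp hξ
  have h := hG.tendsto_smul_base ha hξ g
  exact hu (fun n => a n * g) p ξ ((mul_left_injective g).comp ha)
    (by simpa [mul_smul] using hp) (by simpa [mul_smul] using h)

end IsBasedConvergence

end Dynamics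

/-! ### Limits of powers: parabolic and loxodromic elements -/

section PowerLimits

variable {G M : Type*} [Group G] [TopologicalSpace M] [MulAction G M] {o c d : M} {z : G}

theorem HasPowerLimits.inv (hz : HasPowerLimits z o c d) : HasPowerLimits z⁻¹ o d c where
  injective k l h := neg_injective (hz.injective (by simpa using h))
  tendsto := by simpa using hz.tendsto_inv
  tendsto_inv := by simpa using hz.tendsto

theorem HasPowerLimits.injective_pow (hz : HasPowerLimits z o c d) :
    Function.Injective fun k : ℕ => z ^ k := fun k l h =>
  Nat.cast_injective (R := ℤ) (hz.injective (by simpa using h))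

theorem HasPowerLimits.injective_inv_pow (hz : HasPowerLimits z o c d) :
    Function.Injective fun k : ℕ => (z ^ k)⁻¹ := fun _ _ h =>
  hz.injective_pow (inv_injective h)

variable [CompactSpace M] [T2Space M] [SecondCountableTopology M] [ContinuousConstSMul G M]

namespace HasPowerLimits

omit [CompactSpace M] [SecondCountableTopology M] in
theorem smul_right (hz : HasPowerLimits z o c d) : z • d = d := by
  refine tendsto_nhds_unique (hz.tendsto.const_smul z) ?_
  have := hz.tendsto.comp (tendsto_add_atTop_nat 1)
  refine this.congr fun k => ?_
  simp [pow_succ', mul_smul]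

omit [CompactSpace M] [SecondCountableTopology M] in
theorem smul_left (hz : HasPowerLimits z o c d) : z • c = c := by
  have := hz.inv.smul_right
  rwa [inv_smul_eq_iff, eq_comm] at this

omit [CompactSpace M] [SecondCountableTopology M] in
theorem pow_smul_right (hz : HasPowerLimits z o c d) (k : ℕ) :
    z ^ k • d = d := by
  induction k with
  | zero => simp
  | succ k ih => rw [pow_succ, mul_smul, hz.smul_right, ih]

omit [CompactSpace M] [SecondCountableTopology M] in
theorem pow_smul_left (hz : HasPowerLimits z o c d) (k : ℕ) :
    z ^ k • c = c := by
  have := hz.inv.pow_smul_right k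
  rwa [inv_pow, inv_smul_eq_iff, eq_comm] at this

omit [ContinuousConstSMul G M] in
theorem tendsto_of_ne (hG : IsBasedConvergence G o) (hz : HasPowerLimits z o c d) {x : M}
    (hx : x ≠ c) : Tendsto (fun k : ℕ => z ^ k • x) atTop (𝓝 d) :=
  tendsto_of_forall_subseq fun σ hσ q hq =>
    (hG (fun n => z ^ σ n) (fun _ => x) x q d c (hz.injective_pow.comp hσ.injective)
      tendsto_const_nhds hq (hz.tendsto.comp hσ.tendsto_atTop)
      (hz.tendsto_inv.comp hσ.tendsto_atTop)).resolve_left hx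

omit [ContinuousConstSMul G M] in
theorem eq_or_eq_of_pow_smul (hG : IsBasedConvergence G o) (hz : HasPowerLimits z o c d) {x : M}
    {r : ℕ} (hr : 0 < r) (hx : z ^ r • x = x) : x = c ∨ x = d := by
  by_contra! h
  refine h.2 (tendsto_nhds_unique ?_
    ((hz.tendsto_of_ne hG h.1).comp (tendsto_id.const_mul_atTop' hr)))
  refine tendsto_const_nhds.congr fun n => ?_
  simp only [Function.comp_apply, id, pow_mul]
  induction n with
  | zero => simp
  | succ n ih => rw [pow_succ, mul_smul, hx, ← ih]

omit [ContinuousConstSMul G M] in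
theorem eq_or_eq_of_smul (hG : IsBasedConvergence G o) (hz : HasPowerLimits z o c d) {x : M}
    (hx : z • x = x) : x = c ∨ x = d :=
  hz.eq_or_eq_of_pow_smul hG one_pos (by simpa using hx)

theorem conj (hG : IsBasedConvergence G o) (hz : HasPowerLimits z o c d) (g : G) :
    HasPowerLimits (g * z * g⁻¹) o (g • c) (g • d) where
  injective k l h := hz.injective (by simpa using h)
  tendsto := by
    simpa [mul_smul] using (hG.tendsto_smul_base hz.injective_pow hz.tendsto g⁻¹).const_smul g
  tendsto_inv := by
    simpa [conj_pow, mul_smul] using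
      (hG.tendsto_smul_base hz.injective_inv_pow hz.tendsto_inv g⁻¹).const_smul g

end HasPowerLimits

/-- Accumulation points of the orbit are fixed by `z`, hence are among the two limits `c`, `d` of
one subsequence of powers and their inverses. If both occurred, the orbit would leave a
neighbourhood of `d` infinitely often; the last points inside accumulate at `d`, which is fixed, so
their successors accumulate there too, yet lie outside. -/
theorem exists_tendsto_pow_smul (hG : IsBasedConvergence G o)
    (hz : Function.Injective fun k : ℕ => z ^ k) :
    ∃ d, Tendsto (fun k : ℕ => z ^ k • o) atTop (𝓝 d) := by
  obtain ⟨k, hk, d, c, hd, hc⟩ := exists_limits o fun k : ℕ => z ^ k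
  have hfix : ∀ (σ : ℕ → ℕ) (p : M), StrictMono σ →
      Tendsto (fun n => z ^ σ n • o) atTop (𝓝 p) → z • p = p := fun σ p hσ hp => by
    refine tendsto_nhds_unique (hp.const_smul z) ?_
    refine (hG.tendsto_smul_base (hz.comp hσ.injective) hp z).congr fun n => ?_
    simp only [smul_smul, Function.comp_apply, ← pow_succ, ← pow_succ']
  have hcd : ∀ (σ : ℕ → ℕ) (p : M), StrictMono σ →
      Tendsto (fun n => z ^ σ n • o) atTop (𝓝 p) → p = c ∨ p = d := fun σ p hσ hp => by
    have h1 := hfix σ p hσ hp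
    have h2 : ∀ n : ℕ, z ^ n • p = p := fun n => by
      induction n with
      | zero => simp
      | succ n ih => rw [pow_succ, mul_smul, h1, ih]
    exact hG (fun n => z ^ k n) (fun _ => p) p p d c (hz.comp hk.injective) tendsto_const_nhds
      (by simp [h2]) hd hc
  refine ⟨d, tendsto_of_forall_subseq fun τ hτ q hq => ?_⟩
  by_contra hqd
  have hqc : q = c := (hcd τ q hτ hq).resolve_right hqd
  obtain ⟨U, V, hU, hV, hdU, hcV, hdis⟩ := t2_separation (Ne.symm hqd)
  have hfr : ∃ᶠ n in atTop, z ^ n • o ∈ U ∧ z ^ (n + 1) • o ∉ U := by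
    rw [frequently_atTop]
    intro N
    obtain ⟨n, hn, hnN⟩ := ((hd.eventually (hU.mem_nhds hdU)).and
      (hk.tendsto_atTop.eventually_ge_atTop N)).exists
    obtain ⟨m, hm, hmN⟩ := ((hq.eventually (hV.mem_nhds hcV)).and
      (hτ.tendsto_atTop.eventually_ge_atTop (k n))).exists
    obtain ⟨j, hj, hj'⟩ := exists_exit (P := fun j => z ^ (k n + j) • o ∈ U) hn
      ⟨τ m - k n, fun h => hdis.le_bot ⟨h, by rwa [Nat.add_sub_cancel' hmN]⟩⟩
    exact ⟨k n + j, by omega, hj, hj'⟩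
  obtain ⟨σ, hσ, h⟩ := extraction_of_frequently_atTop hfr
  obtain ⟨b, ρ, hρ, hb⟩ := CompactSpace.tendsto_subseq fun n => z ^ σ n • o
  have hbf := hfix (σ ∘ ρ) b (hσ.comp hρ) hb
  have hbd : b = d := by
    refine (hcd (σ ∘ ρ) b (hσ.comp hρ) hb).resolve_left fun e => ?_
    subst e hqc
    obtain ⟨n, hn⟩ := (hb.eventually (hV.mem_nhds hcV)).exists
    exact hdis.le_bot ⟨(h _).1, hn⟩
  have hb' := hb.const_smul z
  rw [hbf, hbd] at hb'
  obtain ⟨n, hn⟩ := (hb'.eventually (hU.mem_nhds hdU)).exists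
  refine (h (ρ n)).2 ?_
  rwa [pow_succ', mul_smul]

theorem exists_hasPowerLimits (hG : IsBasedConvergence G o)
    (hz : Function.Injective fun k : ℤ => z ^ k) : ∃ c d, HasPowerLimits z o c d := by
  have h1 : Function.Injective fun k : ℕ => z ^ k := fun k l h =>
    Nat.cast_injective (R := ℤ) (hz (by simpa using h))
  obtain ⟨d, hd⟩ := exists_tendsto_pow_smul hG h1
  obtain ⟨c, hc⟩ := exists_tendsto_pow_smul (z := z⁻¹) hG fun k l h => h1 (by simpa using h)
  exact ⟨c, d, hz, hd, by simpa using hc⟩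

/-! ### Parabolic fixed points are not conical -/

/-- The path `a n • z ^ k • o` leads from near `ξ` to near `ζ`, and `a n * z * (a n)⁻¹` shifts it by
one step. The step out of a neighbourhood of `ξ` starts away from the repelling point `ζ` and ends
away from the attracting point `ξ`. -/
theorem HasPowerLimits.not_separating (hG : IsBasedConvergence G o) {m : M}
    (hz : HasPowerLimits z o m m) {a : ℕ → G} {ζ ξ : M} (hne : ξ ≠ ζ)
    (hζ : Tendsto (fun n => a n • m) atTop (𝓝 ζ)) (hξ : Tendsto (fun n => a n • o) atTop (𝓝 ξ))
    (hinj : Function.Injective fun n => a n * z * (a n)⁻¹)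
    (h1 : Tendsto (fun n => (a n * z * (a n)⁻¹) • o) atTop (𝓝 ξ))
    (h2 : Tendsto (fun n => (a n * z * (a n)⁻¹)⁻¹ • o) atTop (𝓝 ζ)) : False := by
  obtain ⟨σ, hσ, k, b, b', hb, hb', hs, hs'⟩ := exists_exit_limits
    (s := fun n k => a n • z ^ k • o) (e := fun n => a n • m) (u := ξ) (v := ζ)
    (by simpa using hξ) (fun n => hz.tendsto.const_smul (a n)) hζ hne
  rcases hG (fun n => a (σ n) * z * (a (σ n))⁻¹) (fun n => a (σ n) • z ^ k n • o) b b' ξ ζ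
    (hinj.comp hσ.injective) hs
    (hs'.congr fun n => by simp [smul_smul, pow_succ', mul_assoc])
    (h1.comp hσ.tendsto_atTop) (h2.comp hσ.tendsto_atTop) with h | h
  · exact hb h
  · exact hb' h

/-- The conjugates `a n * z * (a n)⁻¹` fix `a n • m` and move `a n • o` to `a n • z • o`, which has
the same limit. If they are constant on a subsequence, one parabolic element fixes both limits.
Otherwise both limits are among the attracting and repelling points of the conjugates; if different,
they are these two points, and `not_separating` applies to `z` or `z⁻¹`. -/
theorem HasPowerLimits.isPerspective (hG : IsBasedConvergence G o) {m : M}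
    (hz : HasPowerLimits z o m m) : IsPerspective G o m := by
  intro a ζ ξ ha hζ hξ
  by_contra hne
  obtain ⟨σ, hσ, hp⟩ := exists_subseq_const_or_injective fun n => a n * z * (a n)⁻¹
  have ha' := ha.comp hσ.injective
  have hζ' := hζ.comp hσ.tendsto_atTop
  have hξ' := hξ.comp hσ.tendsto_atTop
  have hz1 : Tendsto (fun n => a (σ n) • z • o) atTop (𝓝 ξ) := hG.tendsto_smul_base ha' hξ' z
  rcases hp with ⟨p, hp⟩ | hp
  · have hpa : ∀ n, p * a (σ n) = a (σ n) * z := fun n => by rw [← hp n]; group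
    have hpl := hz.conj hG (a (σ 0))
    rw [hp 0] at hpl
    have e1 : p • ζ = ζ := by
      refine tendsto_nhds_unique (hζ'.const_smul p) (hζ'.congr fun n => ?_)
      simp only [Function.comp_apply]
      rw [smul_smul, hpa, mul_smul, hz.smul_right]
    have e2 : p • ξ = ξ := by
      refine tendsto_nhds_unique (hξ'.const_smul p) (hz1.congr fun n => ?_)
      simp only [Function.comp_apply]
      rw [smul_smul, smul_smul, hpa]
    have e1' := (or_self_iff.1 (hpl.eq_or_eq_of_smul hG e1))
    have e2' := (or_self_iff.1 (hpl.eq_or_eq_of_smul hG e2))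
    exact hne (e1'.trans e2'.symm)
  · obtain ⟨τ, hτ, ξ₁, η₁, h1, h2⟩ := exists_limits o fun n => a (σ n) * z * (a (σ n))⁻¹
    have hp' := hp.comp hτ.injective
    have hζ' := hζ'.comp hτ.tendsto_atTop
    have hξ' := hξ'.comp hτ.tendsto_atTop
    have c1 := hG _ (fun n => a (σ (τ n)) • m) ζ ζ ξ₁ η₁ hp' hζ'
      (hζ'.congr fun n => by simp [smul_smul]; simp [mul_smul, hz.smul_right]) h1 h2
    have c2 := hG _ (fun n => a (σ (τ n)) • o) ξ ξ ξ₁ η₁ hp' hξ'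
      ((hz1.comp hτ.tendsto_atTop).congr fun n => by simp [smul_smul]) h1 h2
    rcases c1 with rfl | rfl <;> rcases c2 with rfl | rfl
    · exact hne rfl
    · exact hz.not_separating hG (Ne.symm hne) hζ' hξ' hp' h1 h2
    · refine hz.inv.not_separating hG (Ne.symm hne) hζ' hξ'
        (fun m n h => hp' (inv_injective (by simpa [mul_assoc] using h)))
        (h2.congr fun n => by simp [mul_assoc]) (h1.congr fun n => by simp [mul_assoc])
    · exact hne rfl

end PowerLimits

/-! ### Quotients of compact spaces by closed equivalence relations -/

section ClosedRelation

variable {X : Type*} [TopologicalSpace X] [CompactSpace X] [T2Space X] {s : Setoid X}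

/-- The saturation of a closed set is the projection of a compact set. -/
theorem isClosedMap_mk_of_isClosed (hs : IsClosed {p : X × X | s p.1 p.2}) :
    IsClosedMap (Quotient.mk s) := by
  intro C hC
  rw [← isQuotientMap_quotient_mk'.isClosed_preimage]
  have : Quotient.mk s ⁻¹' (Quotient.mk s '' C) =
      Prod.snd '' ({p : X × X | s p.1 p.2} ∩ Prod.fst ⁻¹' C) := by
    ext y
    constructor
    · rintro ⟨x, hx, hxy⟩
      exact ⟨(x, y), ⟨Quotient.exact hxy, hx⟩, rfl⟩
    · rintro ⟨⟨x, y⟩, ⟨h1, h2⟩, rfl⟩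
      exact ⟨x, h2, Quotient.sound h1⟩
  erw [this]
  exact ((hs.inter (hC.preimage continuous_fst)).isCompact.image continuous_snd).isClosed

theorem t2Space_quotient_of_isClosed (hs : IsClosed {p : X × X | s p.1 p.2}) :
    T2Space (Quotient s) := by
  have hcl := isClosedMap_mk_of_isClosed hs
  have hc : ∀ x : X, IsClosed (Quotient.mk s ⁻¹' {Quotient.mk s x}) := fun x => by
    refine IsClosed.preimage continuous_quotient_mk' ?_
    rw [← image_singleton]
    exact hcl _ isClosed_singleton
  refine ⟨fun a b => ?_⟩
  induction a using Quotient.inductionOn with | _ x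
  induction b using Quotient.inductionOn with | _ y
  intro hne
  obtain ⟨U, V, hU, hV, hxU, hyV, hd⟩ := SeparatedNhds.of_isCompact_isCompact (hc x).isCompact
    (hc y).isCompact (Disjoint.preimage _ (disjoint_singleton.2 hne))
  refine ⟨kernImage (Quotient.mk s) U, kernImage (Quotient.mk s) V,
    isClosedMap_iff_kernImage.1 hcl hU, isClosedMap_iff_kernImage.1 hcl hV,
    fun z hz => hxU hz, fun z hz => hyV hz, ?_⟩
  rw [Set.disjoint_left]
  intro a h1 h2
  induction a using Quotient.inductionOn with | _ z
  exact hd.le_bot ⟨h1 rfl, h2 rfl⟩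

-- Fibres are compact, so a neighbourhood of a fibre contains a finite union of basic sets covering
-- it. The sets of points whose fibre lies in such a union are open, since the map is closed, and
-- form a countable base.
omit [T2Space X] in
theorem secondCountableTopology_of_isClosedMap {Y : Type*} [TopologicalSpace Y] [T2Space Y]
    [SecondCountableTopology X] {f : X → Y} (hf : Continuous f) (hs : Function.Surjective f)
    (hcl : IsClosedMap f) : SecondCountableTopology Y := by
  let 𝓑 : Set (Set Y) := (fun F : Set (Set X) => kernImage f (⋃ t ∈ F, t)) ''
    {F | F.Finite ∧ F ⊆ TopologicalSpace.countableBasis X}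
  have hb := TopologicalSpace.isBasis_countableBasis X
  have h𝓑 : TopologicalSpace.IsTopologicalBasis 𝓑 := by
    refine TopologicalSpace.isTopologicalBasis_of_isOpen_of_nhds ?_ ?_
    · rintro _ ⟨F, ⟨-, hF⟩, rfl⟩
      exact isClosedMap_iff_kernImage.1 hcl (isOpen_biUnion fun t ht => hb.isOpen (hF ht))
    · intro y W hy hW
      have hK : IsCompact (f ⁻¹' {y}) := (isClosed_singleton.preimage hf).isCompact
      have hWo := hW.preimage hf
      obtain ⟨F, hF, hFf, hFc⟩ := hK.elim_finite_subcover_image (c := id)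
        (b := {t ∈ TopologicalSpace.countableBasis X | t ⊆ f ⁻¹' W}) (fun t ht => hb.isOpen ht.1)
        (by
          have := hb.open_eq_sUnion' hWo
          rw [Set.sUnion_eq_biUnion] at this
          intro x hx
          exact this ▸ (show x ∈ f ⁻¹' W by rw [mem_preimage, hx]; exact hy))
      refine ⟨_, ⟨F, ⟨hFf, fun t ht => (hF ht).1⟩, rfl⟩, fun x hx => hFc hx, fun w hw => ?_⟩
      obtain ⟨x, rfl⟩ := hs w
      obtain ⟨t, ht, hx⟩ := mem_iUnion₂.1 (hw rfl)
      exact (hF ht).2 hx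
  exact h𝓑.secondCountableTopology
    ((Set.countable_ofPred_finite_subset (TopologicalSpace.countable_countableBasis X)).image _)

end ClosedRelation

/-! ### Passage to equivariant factors -/

section Factor

variable {G M N : Type*} [Group G] [TopologicalSpace M] [CompactSpace M] [T2Space M]
  [SecondCountableTopology M] [MulAction G M] [ContinuousConstSMul G M] {o : M}
  [TopologicalSpace N] [T2Space N] [MulAction G N] {π : M → N}

omit [ContinuousConstSMul G M] in
theorem IsBasedConvergence.map (hG : IsBasedConvergence G o) (hπ : Continuous π)
    (hs : Function.Surjective π) (he : ∀ (g : G) x, π (g • x) = g • π x) :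
    IsBasedConvergence G (π o) := by
  intro a x x' y ξ η ha hx hy hξ hη
  choose w hw using fun n => hs (x n)
  obtain ⟨w', σ, hσ, hw'⟩ := CompactSpace.tendsto_subseq w
  obtain ⟨v, τ, hτ, hv⟩ := CompactSpace.tendsto_subseq fun n => a (σ n) • w (σ n)
  obtain ⟨ρ, hρ, ξ', η', hξ', hη'⟩ := exists_limits o fun n => a (σ (τ n))
  have hρt := hρ.tendsto_atTop
  have hτρ := hτ.tendsto_atTop.comp hρt
  have hall := hσ.tendsto_atTop.comp hτρ
  have e1 : π w' = x' := tendsto_nhds_unique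
    (((hπ.tendsto w').comp (hw'.comp hτρ)).congr fun n => by simp [hw]) (hx.comp hall)
  have e2 : π v = y := tendsto_nhds_unique
    (((hπ.tendsto v).comp (hv.comp hρt)).congr fun n => by simp [hw, he]) (hy.comp hall)
  have e3 : π ξ' = ξ := tendsto_nhds_unique
    (((hπ.tendsto ξ').comp hξ').congr fun n => by simp [he]) (hξ.comp hall)
  have e4 : π η' = η := tendsto_nhds_unique
    (((hπ.tendsto η').comp hη').congr fun n => by simp [he]) (hη.comp hall)
  rcases hG _ _ w' v ξ' η' (ha.comp (hσ.comp (hτ.comp hρ)).injective) (hw'.comp hτρ)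
    (hv.comp hρt) hξ' hη' with h | h
  · exact Or.inl (by rw [← e1, ← e4, h])
  · exact Or.inr (by rw [← e2, ← e3, h])

omit [CompactSpace M] [T2Space M] [SecondCountableTopology M] [ContinuousConstSMul G M]
  [T2Space N] in
theorem HasPowerLimits.map {z : G} {c d : M} (hz : HasPowerLimits z o c d) (hπ : Continuous π)
    (he : ∀ (g : G) x, π (g • x) = g • π x) : HasPowerLimits z (π o) (π c) (π d) where
  injective := hz.injective
  tendsto := ((hπ.tendsto d).comp hz.tendsto).congr fun _ => he _ _
  tendsto_inv := ((hπ.tendsto c).comp hz.tendsto_inv).congr fun _ => he _ _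

omit [CompactSpace M] [T2Space M] [SecondCountableTopology M] [ContinuousConstSMul G M]
  [T2Space N] in
theorem infinite_basedLimitSet_map {H : Set G} (hΛ : (basedLimitSet H o).Infinite)
    (hπ : Continuous π) (he : ∀ (g : G) x, π (g • x) = g • π x)
    (hfin : ∀ x, {y | π y = π x}.Finite) : (basedLimitSet H (π o)).Infinite := by
  intro hf
  have hsub : basedLimitSet H o ⊆ π ⁻¹' (π '' basedLimitSet H o) := subset_preimage_image _ _
  have hsub' : π '' basedLimitSet H o ⊆ basedLimitSet H (π o) := by
    rintro _ ⟨ξ, ⟨a, ha, haH, hξ⟩, rfl⟩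
    exact ⟨a, ha, haH, ((hπ.tendsto ξ).comp hξ).congr fun n => he _ _⟩
  refine hΛ (((hf.subset hsub').preimage' ?_).subset hsub)
  rintro _ ⟨ξ, -, rfl⟩
  exact hfin ξ

end Factor

/-! ### Pinching the fixed points of loxodromic elements -/

section Pinching

variable {G M : Type*} [Group G] [TopologicalSpace M] [CompactSpace M] [T2Space M]
  [SecondCountableTopology M] [MulAction G M] [ContinuousConstSMul G M] {o c d : M} {z : G}

/-- If the attracting point of `w` is the repelling point of `z`, then the repelling point of `w`
is the attracting point of `z`. -/
theorem HasPowerLimits.eq_of_common (hG : IsBasedConvergence G o) {e : M} {w : G}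
    (hz : HasPowerLimits z o c d) (hw : HasPowerLimits w o e c) (hcd : c ≠ d) (hec : e ≠ c) :
    e = d := by
  -- For large `j` the point `w ^ j • o` is near `c`, and the powers of `z` take it to `d`. The last
  -- points near `c` have a limit `b` different from both `c` and `d`.
  obtain ⟨σ, hσ, k, b, b', hbd, hb'c, hb, hb'⟩ := exists_exit_limits
    (s := fun j k => z ^ k • w ^ j • o) (e := fun _ => d) (by simpa using hw.tendsto)
    (fun j => hG.tendsto_smul_base hz.injective_pow hz.tendsto (w ^ j)) tendsto_const_nhds hcd
  have hbc : b ≠ c := by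
    rintro rfl
    refine hb'c (tendsto_nhds_unique hb' ?_)
    simpa [hz.smul_left, pow_succ', mul_smul] using hb.const_smul z
  obtain ⟨τ, hτ, hk⟩ := exists_subseq_const_or_injective k
  have hb := hb.comp hτ.tendsto_atTop
  rcases hk with ⟨K, hK⟩ | hk
  · refine absurd (tendsto_nhds_unique hb ?_) hbc
    have := (hw.tendsto.comp (hσ.comp hτ).tendsto_atTop).const_smul (z ^ K)
    rw [hz.pow_smul_left] at this
    refine this.congr fun n => ?_
    simp [hK]
  have hke : Tendsto (fun n => z ^ k (τ n) • e) atTop (𝓝 d) :=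
    (hz.tendsto_of_ne hG hec).comp hk.nat_tendsto_atTop
  obtain ⟨ρ, hρ, hh⟩ := exists_subseq_const_or_injective fun n => z ^ k (τ n) * w ^ σ (τ n)
  have hb := hb.comp hρ.tendsto_atTop
  have hke := hke.comp hρ.tendsto_atTop
  -- If the products are constant, the points `z ^ k • e` repeat and a power of `z` fixes `e`. If
  -- they are distinct, their attracting point is `b`, while they fix `c` and take `e` to points
  -- converging to `d`; so `c` and `e` would both be the repelling point.
  rcases hh with ⟨h, hh⟩ | hh
  · have h01 : z ^ k (τ (ρ 0)) • e = z ^ k (τ (ρ 1)) • e := by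
      have h0 := congrArg (fun g : G => g • e) ((hh 0).trans (hh 1).symm)
      simpa only [mul_smul, hw.pow_smul_left] using h0
    have hk01 : k (τ (ρ 0)) ≠ k (τ (ρ 1)) := fun h => by
      simpa using hρ.injective (hk h)
    have key : ∀ p q : ℕ, p < q → z ^ p • e = z ^ q • e → e = d := fun p q hpq h => by
      refine (hz.eq_or_eq_of_pow_smul hG (Nat.sub_pos_of_lt hpq) ?_).resolve_left hec
      refine smul_left_cancel (z ^ p) ?_
      rw [smul_smul, ← pow_add, Nat.add_sub_cancel' hpq.le, h]
    rcases lt_or_gt_of_ne hk01 with hlt | hlt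
    · exact key _ _ hlt h01
    · exact key _ _ hlt h01.symm
  · obtain ⟨θ, hθ, ξ, η, hξ, hη⟩ := exists_limits o fun n => z ^ k (τ (ρ n)) * w ^ σ (τ (ρ n))
    have hh := hh.comp hθ.injective
    have hξb : ξ = b := tendsto_nhds_unique hξ
      ((hb.comp hθ.tendsto_atTop).congr fun n => by simp [mul_smul])
    have hcη : c = η := (hG _ (fun _ => c) c c ξ η hh tendsto_const_nhds
      (by simp [mul_smul, hw.pow_smul_right, hz.pow_smul_left]) hξ hη).resolve_right
        (by rw [hξb]; exact hbc.symm)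
    have heη : e = η := (hG _ (fun _ => e) e d ξ η hh tendsto_const_nhds
      ((hke.comp hθ.tendsto_atTop).congr fun n => by simp [mul_smul, hw.pow_smul_left]) hξ hη
        ).resolve_right (by rw [hξb]; exact hbd.symm)
    exact absurd (heη.trans hcη.symm) hec

/-- Two loxodromic elements with a common fixed point have the same fixed points. -/
theorem HasPowerLimits.fixed_eq (hG : IsBasedConvergence G o) {c' d' x : M} {w : G}
    (hz : HasPowerLimits z o c d) (hw : HasPowerLimits w o c' d') (hcd : c ≠ d) (hcd' : c' ≠ d')
    (hx : x = c ∨ x = d) (hx' : x = c' ∨ x = d') {y : M} (hy : y = c' ∨ y = d') :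
    y = c ∨ y = d := by
  rcases hx with rfl | rfl <;> rcases hx' with rfl | rfl
  · rcases hy with rfl | rfl
    · simp
    · exact Or.inr (hz.eq_of_common hG hw.inv hcd hcd'.symm)
  · rcases hy with rfl | rfl
    · exact Or.inr (hz.eq_of_common hG hw hcd hcd')
    · simp
  · rcases hy with rfl | rfl
    · simp
    · exact Or.inl (hz.inv.eq_of_common hG hw.inv hcd.symm hcd'.symm)
  · rcases hy with rfl | rfl
    · exact Or.inl (hz.inv.eq_of_common hG hw hcd.symm hcd')
    · simp

/-- Multiplying `g n` by powers of `z` does not change the images of `c` and `d`, and can be done so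
that `o` goes to points away from `v` and `z • o` to points away from `u`. Were the resulting
elements distinct, their attracting point would differ from `u` and `v`, so that `c` and `d` would
both be repelling. Hence they are constant on a subsequence. -/
theorem HasPowerLimits.exists_eq_smul (hG : IsBasedConvergence G o) (hz : HasPowerLimits z o c d)
    {g : ℕ → G} {u v : M} (hu : Tendsto (fun n => g n • c) atTop (𝓝 u))
    (hv : Tendsto (fun n => g n • d) atTop (𝓝 v)) (huv : u ≠ v) : ∃ h : G, u = h • c ∧ v = h • d := by
  obtain ⟨k₀, hk₀⟩ := exists_diagonal (s := fun n k => g n • (z ^ k)⁻¹ • o)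
    (fun n => hz.tendsto_inv.const_smul (g n)) hu
  obtain ⟨σ, hσ, k, b, b', hbv, hbu, hb, hb'⟩ := exists_exit_limits
    (s := fun n k => (g n * (z ^ k₀ n)⁻¹) • z ^ k • o) (by simpa [mul_smul] using hk₀)
    (fun n => hz.tendsto.const_smul (g n * (z ^ k₀ n)⁻¹)) (v := v)
    (hv.congr fun n => by
      rw [mul_smul]; congr 1; rw [eq_inv_smul_iff, hz.pow_smul_right]) huv
  obtain ⟨τ, hτ, hh⟩ := exists_subseq_const_or_injective
    fun n => g (σ n) * (z ^ k₀ (σ n))⁻¹ * z ^ k n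
  have hc : ∀ n, (g (σ n) * (z ^ k₀ (σ n))⁻¹ * z ^ k n) • c = g (σ n) • c := fun n => by
    rw [mul_smul, mul_smul, hz.pow_smul_left]; congr 1; rw [inv_smul_eq_iff, hz.pow_smul_left]
  have hd : ∀ n, (g (σ n) * (z ^ k₀ (σ n))⁻¹ * z ^ k n) • d = g (σ n) • d := fun n => by
    rw [mul_smul, mul_smul, hz.pow_smul_right]; congr 1; rw [inv_smul_eq_iff, hz.pow_smul_right]
  have hu := hu.comp (hσ.comp hτ).tendsto_atTop
  have hv := hv.comp (hσ.comp hτ).tendsto_atTop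
  have hb := hb.comp hτ.tendsto_atTop
  have hb' := hb'.comp hτ.tendsto_atTop
  rcases hh with ⟨h, hh⟩ | hh
  · refine ⟨h, tendsto_nhds_unique hu ?_, tendsto_nhds_unique hv ?_⟩
    · exact tendsto_const_nhds.congr fun n => by rw [← hh n, hc]; rfl
    · exact tendsto_const_nhds.congr fun n => by rw [← hh n, hd]; rfl
  · exfalso
    obtain ⟨θ, hθ, ξ, η, hξ, hη⟩ := exists_limits o
      fun n => g (σ (τ n)) * (z ^ k₀ (σ (τ n)))⁻¹ * z ^ k (τ n)
    have hh := hh.comp hθ.injective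
    have hθ := hθ.tendsto_atTop
    have hξb : ξ = b := tendsto_nhds_unique hξ ((hb.comp hθ).congr fun n => by simp [mul_smul])
    have hξb' : ξ = b' := tendsto_nhds_unique (hG.tendsto_smul_base hh hξ z)
      ((hb'.comp hθ).congr fun n => by simp [mul_smul, pow_succ])
    have hcη : c = η := (hG _ (fun _ => c) c u ξ η hh tendsto_const_nhds
      ((hu.comp hθ).congr fun n => by simp [← hc]) hξ hη).resolve_right
        (by rw [hξb']; exact hbu.symm)
    have hdη : d = η := (hG _ (fun _ => d) d v ξ η hh tendsto_const_nhds
      ((hv.comp hθ).congr fun n => by simp [← hd]) hξ hη).resolve_right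
        (by rw [hξb]; exact hbv.symm)
    rw [hcη.trans hdη.symm] at hu
    exact huv (tendsto_nhds_unique hu hv)

/-- The equivalence relation which identifies the two fixed points of every conjugate of a
loxodromic element. -/
def pinchSetoid (hG : IsBasedConvergence G o) (hz : HasPowerLimits z o c d) (hcd : c ≠ d) :
    Setoid M where
  r x y := x = y ∨ ∃ g : G, (x = g • c ∨ x = g • d) ∧ (y = g • c ∨ y = g • d)
  iseqv :=
    { refl := fun x => Or.inl rfl
      symm := by
        rintro x y (h | ⟨g, h1, h2⟩)
        · exact Or.inl h.symm
        · exact Or.inr ⟨g, h2, h1⟩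
      trans := by
        rintro x y w (rfl | ⟨g, h1, h2⟩) (rfl | ⟨h, h3, h4⟩)
        · exact Or.inl rfl
        · exact Or.inr ⟨h, h3, h4⟩
        · exact Or.inr ⟨g, h1, h2⟩
        · exact Or.inr ⟨g, h1, (hz.conj hG g).fixed_eq hG (hz.conj hG h)
            ((MulAction.injective g).ne hcd) ((MulAction.injective h).ne hcd) h2 h3 h4⟩ }

/-- Related pairs converging to a point off the diagonal are eventually translates of `(c, d)` or
`(d, c)`. One orientation recurs, and `HasPowerLimits.exists_eq_smul` identifies the limit. -/
theorem isClosed_pinchSetoid (hG : IsBasedConvergence G o) (hz : HasPowerLimits z o c d)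
    (hcd : c ≠ d) : IsClosed {p : M × M | pinchSetoid hG hz hcd p.1 p.2} := by
  refine IsSeqClosed.isClosed fun p q hp hq => ?_
  by_contra hR
  have hne : q.1 ≠ q.2 := fun h => hR (Or.inl h)
  have h1 := (continuous_fst.tendsto q).comp hq
  have h2 := (continuous_snd.tendsto q).comp hq
  have hev : ∀ᶠ n in atTop, ∃ g : G,
      ((p n).1 = g • c ∧ (p n).2 = g • d) ∨ ((p n).1 = g • d ∧ (p n).2 = g • c) := by
    filter_upwards [(h1.prodMk_nhds h2).eventually (isOpen_ne_fun continuous_fst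
      continuous_snd |>.mem_nhds hne)] with n hn
    rcases hp n with h | ⟨g, h | h, h' | h'⟩
    · exact absurd h hn
    · exact absurd (h.trans h'.symm) hn
    · exact ⟨g, Or.inl ⟨h, h'⟩⟩
    · exact ⟨g, Or.inr ⟨h, h'⟩⟩
    · exact absurd (h.trans h'.symm) hn
  have hfr : (∃ᶠ n in atTop, ∃ g : G, (p n).1 = g • c ∧ (p n).2 = g • d) ∨
      ∃ᶠ n in atTop, ∃ g : G, (p n).1 = g • d ∧ (p n).2 = g • c := by
    rw [← frequently_or_distrib]
    exact (hev.mono fun n ⟨g, h⟩ => h.imp (fun h => ⟨g, h⟩) fun h => ⟨g, h⟩).frequently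
  rcases hfr with hfr | hfr
  · obtain ⟨σ, hσ, h⟩ := extraction_of_frequently_atTop hfr
    choose g hg hg' using h
    obtain ⟨k, hk, hk'⟩ := hz.exists_eq_smul hG ((h1.comp hσ.tendsto_atTop).congr hg)
      ((h2.comp hσ.tendsto_atTop).congr hg') hne
    exact hR (Or.inr ⟨k, Or.inl hk, Or.inr hk'⟩)
  · obtain ⟨σ, hσ, h⟩ := extraction_of_frequently_atTop hfr
    choose g hg hg' using h
    obtain ⟨k, hk, hk'⟩ := hz.inv.exists_eq_smul hG ((h1.comp hσ.tendsto_atTop).congr hg)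
      ((h2.comp hσ.tendsto_atTop).congr hg') hne
    exact hR (Or.inr ⟨k, Or.inr hk, Or.inl hk'⟩)

end Pinching

universe u v

/-- Only a loxodromic `z` requires a proper quotient, that by `pinchSetoid`. The finiteness of the
fibres keeps an infinite limit set infinite. -/
theorem exists_pinching {G : Type v} {M : Type u} [Group G] [TopologicalSpace M] [CompactSpace M]
    [T2Space M] [SecondCountableTopology M] [MulAction G M] [ContinuousConstSMul G M] {o : M}
    (hG : IsBasedConvergence G o) {z : G} (hz : Function.Injective fun k : ℤ => z ^ k) :
    ∃ (N : Type u) (_ : TopologicalSpace N) (_ : MulAction G N) (π : M → N),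
      CompactSpace N ∧ T2Space N ∧ SecondCountableTopology N ∧ ContinuousConstSMul G N ∧
      Continuous π ∧ Function.Surjective π ∧ (∀ (g : G) x, π (g • x) = g • π x) ∧
      (∀ x, {y | π y = π x}.Finite) ∧ ∃ m, HasPowerLimits z (π o) m m := by
  obtain ⟨c, d, hcd⟩ := exists_hasPowerLimits hG hz
  rcases eq_or_ne c d with rfl | hne
  · exact ⟨M, _, _, id, inferInstance, inferInstance, inferInstance, inferInstance, continuous_id,
      Function.surjective_id, fun _ _ => rfl, fun x => by simp, c, hcd⟩
  let s := pinchSetoid hG hcd hne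
  have hs := isClosed_pinchSetoid hG hcd hne
  have hT2 : T2Space (Quotient s) := t2Space_quotient_of_isClosed hs
  let act : MulAction G (Quotient s) :=
    { smul := fun g => Quotient.map (g • ·) (by
        rintro x y (rfl | ⟨h, h1, h2⟩)
        · exact Or.inl rfl
        · exact Or.inr ⟨g * h, h1.imp (by rintro rfl; simp [mul_smul]) (by rintro rfl; simp [mul_smul]),
            h2.imp (by rintro rfl; simp [mul_smul]) (by rintro rfl; simp [mul_smul])⟩)
      one_smul := fun q => Quotient.inductionOn q fun x => congrArg (Quotient.mk s) (one_smul G x)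
      mul_smul := fun g h q =>
        Quotient.inductionOn q fun x => congrArg (Quotient.mk s) (mul_smul g h x) }
  have hsc : SecondCountableTopology (Quotient s) := secondCountableTopology_of_isClosedMap
    (f := Quotient.mk s) continuous_quotient_mk' Quotient.mk_surjective (isClosedMap_mk_of_isClosed hs)
  refine ⟨Quotient s, inferInstance, act, Quotient.mk s, inferInstance, hT2, hsc, ⟨fun g => ?_⟩,
    continuous_quotient_mk', Quotient.mk_surjective, fun g x => rfl, fun x => ?_,
    Quotient.mk s c, ?_⟩
  · exact isQuotientMap_quotient_mk'.continuous_iff.2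
      (continuous_quotient_mk'.comp (continuous_const_smul g))
  · by_cases hx : ∃ g : G, x = g • c ∨ x = g • d
    · obtain ⟨g, hg⟩ := hx
      refine (Set.toFinite {g • c, g • d}).subset fun y hy => ?_
      rcases (Quotient.exact hy : pinchSetoid hG hcd hne y x) with rfl | ⟨h, h1, h2⟩
      · exact hg
      · exact (hcd.conj hG g).fixed_eq hG (hcd.conj hG h)
          ((MulAction.injective g).ne hne) ((MulAction.injective h).ne hne) hg h2 h1
    · refine (Set.finite_singleton x).subset fun y hy => ?_
      rcases (Quotient.exact hy : pinchSetoid hG hcd hne y x) with rfl | ⟨h, h1, h2⟩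
      · rfl
      · exact absurd ⟨h, h2⟩ hx
  · have := hcd.map (π := Quotient.mk s) continuous_quotient_mk' fun g x => rfl
    rwa [show Quotient.mk s d = Quotient.mk s c from
      Quotient.sound (Or.inr ⟨1, Or.inr (by simp), Or.inl (by simp)⟩)] at this

/-- Every finite family of elements of infinite order becomes parabolic in a suitable factor. -/
theorem exists_parabolic {G : Type v} [Group G] {Z : Set G} (hZ : Z.Finite)
    (hinf : ∀ z ∈ Z, Function.Injective fun k : ℤ => z ^ k) {M : Type u} [TopologicalSpace M]
    [CompactSpace M] [T2Space M] [SecondCountableTopology M] [MulAction G M]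
    [ContinuousConstSMul G M] {o : M} (hG : IsBasedConvergence G o)
    (hΛ : (basedLimitSet (univ : Set G) o).Infinite) :
    ∃ (N : Type u) (_ : TopologicalSpace N) (_ : MulAction G N) (o' : N),
      CompactSpace N ∧ T2Space N ∧ SecondCountableTopology N ∧ ContinuousConstSMul G N ∧
      IsBasedConvergence G o' ∧ (basedLimitSet (univ : Set G) o').Infinite ∧
      ∀ z ∈ Z, ∃ m, HasPowerLimits z o' m m := by
  induction Z, hZ using Set.Finite.induction_on with
  | empty => exact ⟨M, _, _, o, inferInstance, inferInstance, inferInstance, inferInstance, hG, hΛ,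
      by simp⟩
  | insert _ _ ih =>
    obtain ⟨N, _, _, o', _, _, _, _, hG', hΛ', hZ'⟩ := ih fun z hz => hinf z (Or.inr hz)
    obtain ⟨N', _, _, π, _, _, _, _, hπ, hs, he, hf, hm⟩ :=
      exists_pinching hG' (hinf _ (Or.inl rfl))
    refine ⟨N', _, _, π o', inferInstance, inferInstance, inferInstance, inferInstance,
      hG'.map hπ hs he, infinite_basedLimitSet_map hΛ' hπ he hf, ?_⟩
    rintro z (rfl | hz)
    · exact hm
    · obtain ⟨m, hm⟩ := hZ' z hz
      exact ⟨π m, hm.map hπ he⟩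

/-- On a finite invariant limit set some sequence of distinct elements acts by one and the same
permutation. By the convergence property this permutation is constant off one point, which three
points exclude. -/
theorem infinite_basedLimitSet {G M : Type*} [Group G] [TopologicalSpace M] [CompactSpace M]
    [T2Space M] [SecondCountableTopology M] [MulAction G M] [ContinuousConstSMul G M] {o : M}
    (hG : IsBasedConvergence G o) (h : 2 < (basedLimitSet (univ : Set G) o).encard) :
    (basedLimitSet (univ : Set G) o).Infinite := by
  intro hfin
  set Λ := basedLimitSet (univ : Set G) o with hΛ
  have hinv : ∀ (g : G), ∀ x ∈ Λ, g • x ∈ Λ := by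
    rintro g x ⟨a, ha, -, hx⟩
    exact ⟨fun n => g * a n, (mul_right_injective g).comp ha, fun _ => mem_univ _,
      (hx.const_smul g).congr fun n => (mul_smul _ _ _).symm⟩
  obtain ⟨-, a, ha, -, -⟩ : Λ.Nonempty := by
    rw [← Set.encard_pos]
    exact lt_trans (by norm_num) h
  have := hfin.to_subtype
  obtain ⟨σ, hσ, hc⟩ := exists_subseq_const_or_injective
    fun n (x : Λ) => (⟨a n • x, hinv _ _ x.2⟩ : Λ)
  rcases hc with ⟨f, hf⟩ | hc
  · obtain ⟨τ, hτ, ξ, η, hξ, hη⟩ := exists_limits o fun n => a (σ n)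
    have key : ∀ x ∈ Λ, x ≠ η → a (σ (τ 0)) • x = ξ := fun x hx hxη => by
      refine (hG _ (fun _ => x) x (a (σ (τ 0)) • x) ξ η
        (ha.comp (hσ.comp hτ).injective) tendsto_const_nhds ?_ hξ hη).resolve_left hxη
      refine tendsto_const_nhds.congr fun n => ?_
      have h1 := congrArg Subtype.val (congrFun (hf (τ 0)) ⟨x, hx⟩)
      have h2 := congrArg Subtype.val (congrFun (hf (τ n)) ⟨x, hx⟩)
      exact h1.trans h2.symm
    have h1 : 1 < (Λ \ {η}).encard := by
      by_contra! hle
      have := (Set.encard_le_encard_sdiff_add_encard Λ {η}).trans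
        (add_le_add hle (Set.encard_singleton η).le)
      rw [one_add_one_eq_two] at this
      exact absurd h this.not_gt
    obtain ⟨x, y, hx, hy, hxy⟩ := Set.one_lt_encard_iff.1 h1
    exact hxy (smul_left_cancel _ ((key x hx.1 hx.2).trans (key y hy.1 hy.2).symm))
  · exact not_injective_infinite_finite _ hc

/-! ### Trees of convergence spaces -/

/-- The map `π` from `Γ` to an `A`-space `M` behaves like the nearest point projection to the
vertex space of the subgroup `A` in a tree of spaces on which `Γ` acts. -/
structure IsTreeProjection {A Γ M : Type*} [Group A] [Group Γ] [TopologicalSpace M] [MulAction A M]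
    (o : M) (j : A →* Γ) (π : Γ → M) : Prop where
  injective : Function.Injective j
  map_one : π 1 = o
  map_mul : ∀ a x, π (j a * x) = a • π x
  dichotomy : ∀ g ∉ j.range, ∀ x, π x = π g ∨ π (g⁻¹ * x) = π g⁻¹
  map_mul_right : ∀ g ∉ j.range, ∀ a, π (g * j a) = π g
  finite : ∀ x y, ∃ F : Set Γ, F.Finite ∧ ∀ g, π (g⁻¹ * x) ≠ π (g⁻¹ * y) → ∃ f ∈ F, f⁻¹ * g ∈ j.range
  perspective : ∀ x, IsPerspective A o (π x)

section TreeSpace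

variable {A Γ M : Type*} [Group A] [Group Γ] [TopologicalSpace M]

/-- The projections of an element of `Γ` to all translates of the vertex space. -/
def treeMap (π : Γ → M) (x : Γ) : Γ → M := fun g => π (g⁻¹ * x)

/-- The tree of spaces obtained from the translates of `M`: the closure of `Γ` in the product of
all translates. -/
def TreeSpace (π : Γ → M) : Type _ := closure (range (treeMap π))

instance (π : Γ → M) : TopologicalSpace (TreeSpace π) :=
  inferInstanceAs (TopologicalSpace (closure (range (treeMap π))))

instance (π : Γ → M) [CompactSpace M] : CompactSpace (TreeSpace π) :=
  isCompact_iff_compactSpace.1 isClosed_closure.isCompact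

instance (π : Γ → M) [T2Space M] : T2Space (TreeSpace π) :=
  inferInstanceAs (T2Space (closure (range (treeMap π))))

instance (π : Γ → M) [Countable Γ] [SecondCountableTopology M] :
    SecondCountableTopology (TreeSpace π) :=
  inferInstanceAs (SecondCountableTopology (closure (range (treeMap π))))

theorem TreeSpace.shift_mem {π : Γ → M} (γ : Γ) {m : Γ → M} (hm : m ∈ closure (range (treeMap π))) :
    (fun g => m (γ⁻¹ * g)) ∈ closure (range (treeMap π)) := by
  refine map_mem_closure (f := fun (m : Γ → M) g => m (γ⁻¹ * g))
    (continuous_pi fun g => continuous_apply _) hm ?_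
  rintro _ ⟨x, rfl⟩
  exact ⟨γ * x, by ext g; simp [treeMap, mul_assoc]⟩

instance (π : Γ → M) : MulAction Γ (TreeSpace π) where
  smul γ m := ⟨fun g => m.1 (γ⁻¹ * g), TreeSpace.shift_mem γ m.2⟩
  one_smul m := Subtype.ext (funext fun g => congrArg m.1 (by simp))
  mul_smul γ δ m := Subtype.ext (funext fun g => congrArg m.1 (by simp [mul_assoc]))

theorem TreeSpace.smul_apply {π : Γ → M} (γ : Γ) (m : TreeSpace π) (g : Γ) :
    (γ • m).1 g = m.1 (γ⁻¹ * g) := rfl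

theorem TreeSpace.continuous_apply {π : Γ → M} (g : Γ) : Continuous fun m : TreeSpace π => m.1 g :=
  (_root_.continuous_apply g).comp continuous_subtype_val

instance (π : Γ → M) : ContinuousConstSMul Γ (TreeSpace π) where
  continuous_const_smul γ := Continuous.subtype_mk
    (continuous_pi fun g => TreeSpace.continuous_apply (γ⁻¹ * g)) _

/-- The point of the tree of spaces given by an element of `Γ`. -/
def TreeSpace.of (π : Γ → M) (x : Γ) : TreeSpace π := ⟨treeMap π x, subset_closure ⟨x, rfl⟩⟩

theorem TreeSpace.smul_of (π : Γ → M) (γ x : Γ) : γ • TreeSpace.of π x = TreeSpace.of π (γ * x) :=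
  Subtype.ext (funext fun g => by rw [smul_apply]; simp [of, treeMap, mul_assoc])

theorem TreeSpace.of_apply (π : Γ → M) (x g : Γ) : (TreeSpace.of π x).1 g = π (g⁻¹ * x) := rfl

theorem TreeSpace.smul_of_one (π : Γ → M) (γ : Γ) : γ • TreeSpace.of π 1 = TreeSpace.of π γ := by
  rw [smul_of, mul_one]

theorem TreeSpace.tendsto_of {π : Γ → M} {ι : Type*} {l : Filter ι} [l.NeBot] {x : ι → Γ} {m : Γ → M}
    (h : ∀ g, Tendsto (fun i => π (g⁻¹ * x i)) l (𝓝 (m g))) :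
    ∃ hm : m ∈ closure (range (treeMap π)),
      Tendsto (fun i => TreeSpace.of π (x i)) l (𝓝 (⟨m, hm⟩ : TreeSpace π)) := by
  have ht : Tendsto (fun i => treeMap π (x i)) l (𝓝 m) := tendsto_pi_nhds.2 h
  have hm : m ∈ closure (range (treeMap π)) :=
    mem_closure_of_tendsto ht (Eventually.of_forall fun i => ⟨x i, rfl⟩)
  exact ⟨hm, tendsto_subtype_rng.2 ht⟩

variable [CompactSpace M] [T2Space M] [SecondCountableTopology M] [MulAction A M]
  [ContinuousConstSMul A M] {o : M} {j : A →* Γ} {π : Γ → M}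

namespace IsTreeProjection

omit [CompactSpace M] [SecondCountableTopology M] in
theorem apply_mul (h : IsTreeProjection o j π) (m : TreeSpace π) (g : Γ) (a : A) :
    m.1 (g * j a) = a⁻¹ • m.1 g := by
  have hcl : IsClosed {m : Γ → M | m (g * j a) = a⁻¹ • m g} :=
    isClosed_eq (continuous_apply _) ((continuous_apply _).const_smul _)
  refine hcl.closure_subset_iff.2 ?_ m.2
  rintro _ ⟨x, rfl⟩
  simp [treeMap, ← h.map_mul, mul_assoc]

omit [CompactSpace M] [SecondCountableTopology M] [ContinuousConstSMul A M] in
theorem apply_dichotomy (h : IsTreeProjection o j π) (m : TreeSpace π) {g k : Γ}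
    (hgk : g⁻¹ * k ∉ j.range) : m.1 g = π (g⁻¹ * k) ∨ m.1 k = π (k⁻¹ * g) := by
  have hcl : IsClosed {m : Γ → M | m g = π (g⁻¹ * k) ∨ m k = π (k⁻¹ * g)} :=
    (isClosed_eq (continuous_apply _) continuous_const).union
      (isClosed_eq (continuous_apply _) continuous_const)
  refine hcl.closure_subset_iff.2 ?_ m.2
  rintro _ ⟨x, rfl⟩
  simpa [treeMap, mul_assoc] using h.dichotomy _ hgk (g⁻¹ * x)

-- Only finitely many translates of the vertex space separate `x` from `y`, so infinitely many `k n`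
-- lie in one coset.
omit [ContinuousConstSMul A M] [SecondCountableTopology M] [CompactSpace M] [T2Space M] in
theorem exists_subseq_coset (h : IsTreeProjection o j π) (x y : Γ) {k : ℕ → Γ}
    (hk : ∀ᶠ n in atTop, π ((k n)⁻¹ * x) ≠ π ((k n)⁻¹ * y)) (hinj : Function.Injective k) :
    ∃ (f : Γ) (σ : ℕ → ℕ) (a : ℕ → A), StrictMono σ ∧ Function.Injective a ∧
      ∀ n, k (σ n) = f * j (a n) := by
  obtain ⟨F, hF, hFk⟩ := h.finite x y
  have hfr : ∃ᶠ n in atTop, ∃ f ∈ F, f⁻¹ * k n ∈ j.range := (hk.mono fun n hn => hFk _ hn).frequently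
  obtain ⟨σ, hσ, hf⟩ := extraction_of_frequently_atTop hfr
  choose f hf a ha using hf
  obtain ⟨τ, hτ, hc⟩ := exists_subseq_const_or_injective f
  rcases hc with ⟨f₀, hf₀⟩ | hc
  · have e : ∀ n, k (σ (τ n)) = f₀ * j (a (τ n)) := fun n => by rw [ha, hf₀]; group
    refine ⟨f₀, σ ∘ τ, a ∘ τ, hσ.comp hτ, fun m n hmn => ?_, e⟩
    refine (hinj.comp (hσ.comp hτ).injective) ?_
    have : a (τ m) = a (τ n) := hmn
    simp only [Function.comp_apply, e, this]
  · have := hF.to_subtype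
    exact absurd (fun m n hmn => hc (congrArg Subtype.val hmn))
      (not_injective_infinite_finite fun n => (⟨f (τ n), hf (τ n)⟩ : F))

-- Both sequences are images under `(a n)⁻¹` of fixed points, `π (f⁻¹ * x)` and `π (f⁻¹ * y)`, which
-- are perspective to `o`.
omit [SecondCountableTopology M] [ContinuousConstSMul A M] in
theorem eq_of_coset [SecondCountableTopology M] (h : IsTreeProjection o j π) {f x y : Γ} {a : ℕ → A}
    (ha : Function.Injective a) {p q : M}
    (hp : Tendsto (fun n => π ((f * j (a n))⁻¹ * x)) atTop (𝓝 p))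
    (hq : Tendsto (fun n => π ((f * j (a n))⁻¹ * y)) atTop (𝓝 q)) : p = q := by
  have e : ∀ z n, π ((f * j (a n))⁻¹ * z) = (a n)⁻¹ • π (f⁻¹ * z) := fun z n => by
    rw [← h.map_mul]; simp [mul_assoc]
  simp only [e] at hp hq
  exact (h.perspective (f⁻¹ * x)).eq (h.perspective (f⁻¹ * y))
    (fun m n hmn => ha (inv_injective hmn)) hp hq

/-- In a counterexample `x'` and `η` differ over a translate `g`, and `y` and `ξ` over a translate
`h'`. If `g` and `(γ n)⁻¹ * h'` give the same translate, the convergence property of `M` applies.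
Otherwise `x n` projects to one of them as the other one does. Then varying translates separate a
fixed pair of elements of `Γ` in the limit, against finiteness and perspectivity. -/
theorem isBasedConvergence (hA : IsBasedConvergence A o) (h : IsTreeProjection o j π) :
    IsBasedConvergence Γ (TreeSpace.of π 1) := by
  intro γ x x' y ξ η hγ hx hy hξ hη
  by_contra! hne
  obtain ⟨g, hg⟩ : ∃ g, x'.1 g ≠ η.1 g := by
    by_contra! hall; exact hne.1 (Subtype.ext (funext hall))
  obtain ⟨h', hh'⟩ : ∃ h', y.1 h' ≠ ξ.1 h' := by
    by_contra! hall; exact hne.2 (Subtype.ext (funext hall))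
  have cont : ∀ (s : ℕ → TreeSpace π) (p : TreeSpace π) (g : Γ), Tendsto s atTop (𝓝 p) →
      Tendsto (fun n => (s n).1 g) atTop (𝓝 (p.1 g)) := fun s p g hs =>
    ((TreeSpace.continuous_apply g).tendsto p).comp hs
  have l1 := cont _ _ g hx
  have l2 : Tendsto (fun n => (x n).1 ((γ n)⁻¹ * h')) atTop (𝓝 (y.1 h')) := cont _ _ h' hy
  have l3 : Tendsto (fun n => π (((γ n)⁻¹ * h')⁻¹ * 1)) atTop (𝓝 (ξ.1 h')) :=
    (cont _ _ h' hξ).congr fun n => by simp [TreeSpace.smul_apply, TreeSpace.of_apply]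
  have l4 : Tendsto (fun n => π ((γ n * g)⁻¹ * 1)) atTop (𝓝 (η.1 g)) :=
    (cont _ _ g hη).congr fun n => by simp [TreeSpace.smul_apply, TreeSpace.of_apply]
  have hkinj : Function.Injective fun n => (γ n)⁻¹ * h' := fun m n hmn =>
    hγ (inv_injective (mul_right_cancel hmn))
  obtain ⟨σ, hσ, hc⟩ : ∃ σ : ℕ → ℕ, StrictMono σ ∧
      ((∀ n, g⁻¹ * ((γ (σ n))⁻¹ * h') ∈ j.range) ∨
        (∀ n, (x (σ n)).1 ((γ (σ n))⁻¹ * h') = π (((γ (σ n))⁻¹ * h')⁻¹ * g)) ∨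
        ∀ n, (x (σ n)).1 g = π ((γ (σ n) * g)⁻¹ * h')) := by
    have hev : ∀ n, (g⁻¹ * ((γ n)⁻¹ * h') ∈ j.range) ∨
        ((x n).1 ((γ n)⁻¹ * h') = π (((γ n)⁻¹ * h')⁻¹ * g)) ∨
        (x n).1 g = π ((γ n * g)⁻¹ * h') := fun n => by
      by_cases hr : g⁻¹ * ((γ n)⁻¹ * h') ∈ j.range
      · exact Or.inl hr
      · rcases h.apply_dichotomy (x n) hr with h1 | h1
        · exact Or.inr (Or.inr (by rw [h1]; simp [mul_assoc]))
        · exact Or.inr (Or.inl h1)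
    have hfr := (Eventually.of_forall hev : ∀ᶠ n in atTop, _).frequently
    rw [frequently_or_distrib, frequently_or_distrib] at hfr
    rcases hfr with hfr | hfr | hfr <;> obtain ⟨σ, hσ, hc⟩ := extraction_of_frequently_atTop hfr
    · exact ⟨σ, hσ, Or.inl hc⟩
    · exact ⟨σ, hσ, Or.inr (Or.inl hc)⟩
    · exact ⟨σ, hσ, Or.inr (Or.inr hc)⟩
  have hσt := hσ.tendsto_atTop
  rcases hc with hc | hc | hc
  -- Same translate: `(a n)⁻¹` takes the coordinate of `x n` at `g` to that at `(γ n)⁻¹ * h'`.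
  · choose a ha using hc
    have e : ∀ n, (γ (σ n))⁻¹ * h' = g * j (a n) := fun n => by rw [ha]; group
    have e' : ∀ n, (γ (σ n))⁻¹ = g * j (a n) * h'⁻¹ := fun n => by rw [← e]; group
    have hainj : Function.Injective fun n => (a n)⁻¹ := fun m n hmn =>
      (hkinj.comp hσ.injective) (by simp only [Function.comp_apply, e, inv_injective hmn])
    obtain ⟨τ, hτ, ξ₁, η₁, h1, h2⟩ := exists_limits o fun n => (a n)⁻¹
    have hainj := hainj.comp hτ.injective
    have hτt := hτ.tendsto_atTop
    have hainj' : Function.Injective fun n => a (τ n) := fun m n hmn => hainj (congrArg (·⁻¹) hmn)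
    simp only [inv_inv] at h2
    have e1 : ξ.1 h' = ξ₁ := by
      refine h.perspective (g⁻¹ * 1) _ _ _ hainj (((l3.comp hσt).comp hτt).congr fun n => ?_) h1
      simp only [Function.comp_apply, e]
      rw [← h.map_mul]; simp
    have e2 : η.1 g = η₁ := by
      refine h.perspective h'⁻¹ _ _ _ hainj' (((l4.comp hσt).comp hτt).congr fun n => ?_) h2
      simp only [Function.comp_apply, mul_inv_rev, e']
      rw [← h.map_mul]; simp [mul_assoc]
    rcases hA _ (fun n => (x (σ (τ n))).1 g) (x'.1 g) (y.1 h') ξ₁ η₁ hainj ((l1.comp hσt).comp hτt)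
      (((l2.comp hσt).comp hτt).congr fun n => by
        simp only [Function.comp_apply, e]; exact h.apply_mul _ _ _) h1
      (by simpa using h2) with h3 | h3
    · exact hg (h3.trans e2.symm)
    · exact hh' (h3.trans e1.symm)
  -- Here the translates `(γ n)⁻¹ * h'` separate `g` from `1`; in the last case `γ n * g` separates
  -- `h'` from `1`.
  · have l2' := (l2.comp hσt).congr hc
    have l3' := l3.comp hσt
    obtain ⟨f, τ, a, hτ, ha, hfa⟩ := h.exists_subseq_coset g 1
      (k := fun n => (γ (σ n))⁻¹ * h') (by
        have := (l2'.prodMk_nhds l3').eventually (isOpen_ne_fun continuous_fst continuous_snd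
          |>.mem_nhds hh')
        exact this) (hkinj.comp hσ.injective)
    refine hh' (h.eq_of_coset (f := f) (x := g) (y := 1) ha
      ((l2'.comp hτ.tendsto_atTop).congr fun n => ?_) ((l3'.comp hτ.tendsto_atTop).congr fun n => ?_))
    · simp only [Function.comp_apply, ← hfa]
    · simp only [Function.comp_apply, ← hfa]
  · have l1' := (l1.comp hσt).congr hc
    have l4' := l4.comp hσt
    obtain ⟨f, τ, a, hτ, ha, hfa⟩ := h.exists_subseq_coset h' 1 (k := fun n => γ (σ n) * g) (by
        have := (l1'.prodMk_nhds l4').eventually (isOpen_ne_fun continuous_fst continuous_snd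
          |>.mem_nhds hg)
        exact this) (fun m n hmn => hσ.injective (hγ (mul_right_cancel hmn)))
    refine hg (h.eq_of_coset (f := f) (x := h') (y := 1) ha
      ((l1'.comp hτ.tendsto_atTop).congr fun n => ?_) ((l4'.comp hτ.tendsto_atTop).congr fun n => ?_))
    · simp only [Function.comp_apply, ← hfa]
    · simp only [Function.comp_apply, ← hfa]

omit [CompactSpace M] [T2Space M] [SecondCountableTopology M] in
/-- The sequence `j (a n)` converges in the tree of spaces if `a n` converges in `M`. -/
theorem exists_tendsto (h : IsTreeProjection o j π) {ι : Type*} {l : Filter ι} [l.NeBot] {ξ : M} :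
    ∃ m : Γ → M, m 1 = ξ ∧ ∀ a : ι → A, Tendsto (fun i => a i • o) l (𝓝 ξ) →
      ∃ hm : m ∈ closure (range (treeMap π)),
        Tendsto (fun i => j (a i) • TreeSpace.of π 1) l (𝓝 (⟨m, hm⟩ : TreeSpace π)) := by
  classical
  -- The projection of `A` to any other translate is constant, so the limit depends on `ξ` only and
  -- not on the sequence.
  refine ⟨fun g => if hg : ∃ b, j b = g then hg.choose⁻¹ • ξ else π g⁻¹, ?_, fun a ha => ?_⟩
  · have h1 : ∃ b, j b = 1 := ⟨1, MonoidHom.map_one j⟩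
    have e : h1.choose = 1 := h.injective (h1.choose_spec.trans (MonoidHom.map_one j).symm)
    simp only [dif_pos h1, e, inv_one, one_smul]
  · simp only [TreeSpace.smul_of_one]
    refine TreeSpace.tendsto_of fun g => ?_
    by_cases hg : ∃ b, j b = g
    · rw [dif_pos hg]
      refine (ha.const_smul (hg.choose⁻¹)).congr fun i => ?_
      conv_rhs => rw [← hg.choose_spec, ← map_inv, h.map_mul, ← mul_one (j (a i)), h.map_mul, h.map_one]
    · rw [dif_neg hg]
      refine tendsto_const_nhds.congr fun i => ?_
      exact (h.map_mul_right _ (fun ⟨b, hb⟩ => hg ⟨b⁻¹, by simp [hb]⟩) _).symm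

-- The limit point in `exists_tendsto` is the same for all sequences with a given limit in `M`, so
-- positive and negative powers still have a common limit.
omit [CompactSpace M] [T2Space M] [SecondCountableTopology M] in
theorem hasPowerLimits (h : IsTreeProjection o j π) {z : A} {m : M} (hz : HasPowerLimits z o m m) :
    ∃ m', HasPowerLimits (j z) (TreeSpace.of π 1) m' m' := by
  obtain ⟨m', -, hm'⟩ := h.exists_tendsto (ι := ℕ) (l := atTop) (ξ := m)
  obtain ⟨h1, h1'⟩ := hm' _ hz.tendsto
  obtain ⟨h2, h2'⟩ := hm' _ hz.tendsto_inv
  exact ⟨⟨m', h1⟩, fun k l hkl => hz.injective (h.injective (by simpa using hkl)),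
    by simpa using h1', by simpa using h2'⟩

omit [CompactSpace M] [T2Space M] [SecondCountableTopology M] in
theorem infinite_basedLimitSet (h : IsTreeProjection o j π) {H : Set A}
    (hΛ : (basedLimitSet H o).Infinite) : (basedLimitSet (j '' H) (TreeSpace.of π 1)).Infinite := by
  intro hf
  refine hΛ ((hf.image fun m => m.1 1).subset ?_)
  rintro ξ ⟨a, ha, haH, hξ⟩
  obtain ⟨m, hm1, hm⟩ := h.exists_tendsto (ι := ℕ) (l := atTop) (ξ := ξ)
  obtain ⟨hm', hlim⟩ := hm a hξ
  exact ⟨⟨m, hm'⟩, ⟨fun n => j (a n), h.injective.comp ha, fun n => mem_image_of_mem j (haH n), hlim⟩,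
    hm1⟩

end IsTreeProjection

/-- The finiteness condition of a tree projection need only be checked on generators. -/
theorem finite_cosets_of_closure {A Γ M : Type*} [Group A] [Group Γ] {j : A →* Γ} {π : Γ → M}
    {S : Set Γ} (hS : Subgroup.closure S = ⊤)
    (h : ∀ s ∈ S, ∃ F : Set Γ, F.Finite ∧ ∀ g, π g⁻¹ ≠ π (g⁻¹ * s) → ∃ f ∈ F, f⁻¹ * g ∈ j.range)
    (x y : Γ) : ∃ F : Set Γ, F.Finite ∧
      ∀ g, π (g⁻¹ * x) ≠ π (g⁻¹ * y) → ∃ f ∈ F, f⁻¹ * g ∈ j.range := by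
  have key : ∀ s : Γ, ∃ F : Set Γ, F.Finite ∧
      ∀ g, π g⁻¹ ≠ π (g⁻¹ * s) → ∃ f ∈ F, f⁻¹ * g ∈ j.range := fun s => by
    have hs : s ∈ Subgroup.closure S := hS ▸ Subgroup.mem_top s
    induction hs using Subgroup.closure_induction with
    | mem s hs => exact h s hs
    | one => exact ⟨∅, finite_empty, fun g hg => absurd (by simp) hg⟩
    | mul s t _ _ hs ht =>
      obtain ⟨F, hF, hF'⟩ := hs
      obtain ⟨E, hE, hE'⟩ := ht
      refine ⟨F ∪ (s * ·) '' E, hF.union (hE.image _), fun g hg => ?_⟩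
      by_cases h1 : π g⁻¹ = π (g⁻¹ * s)
      · obtain ⟨f, hf, hfg⟩ := hE' (s⁻¹ * g) (by simpa [mul_assoc, ← h1] using hg)
        exact ⟨s * f, Or.inr ⟨f, hf, rfl⟩, by simpa [mul_assoc] using hfg⟩
      · obtain ⟨f, hf, hfg⟩ := hF' g h1
        exact ⟨f, Or.inl hf, hfg⟩
    | inv s _ hs =>
      obtain ⟨F, hF, hF'⟩ := hs
      refine ⟨(s⁻¹ * ·) '' F, hF.image _, fun g hg => ?_⟩
      obtain ⟨f, hf, hfg⟩ := hF' (s * g) (by simpa [mul_assoc] using Ne.symm hg)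
      exact ⟨s⁻¹ * f, ⟨f, hf, rfl⟩, by simpa [mul_assoc] using hfg⟩
  obtain ⟨F, hF, hF'⟩ := key (x⁻¹ * y)
  refine ⟨(x * ·) '' F, hF.image _, fun g hg => ?_⟩
  obtain ⟨f, hf, hfg⟩ := hF' (x⁻¹ * g) (by simpa [mul_assoc] using hg)
  exact ⟨x * f, ⟨f, hf, rfl⟩, by simpa [mul_assoc] using hfg⟩

end TreeSpace

/-! ### The word metric -/

section WordMetric

variable {G : Type*} [Group G] {S : Set G}

/-- Left translation as an endomorphism of the Cayley graph. -/
def cayleyTranslation (S : Set G) (g : G) :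
    SimpleGraph.mulCayley S →g SimpleGraph.mulCayley S where
  toFun x := g * x
  map_rel' h := SimpleGraph.mulCayley_adj_mul_iff_right.2 h

theorem mulCayley_connected (hS : Subgroup.closure S = ⊤) : (SimpleGraph.mulCayley S).Connected := by
  have key : ∀ g x : G, (SimpleGraph.mulCayley S).Reachable x (x * g) := fun g => by
    have hg : g ∈ Subgroup.closure S := hS ▸ Subgroup.mem_top g
    induction hg using Subgroup.closure_induction with
    | mem s hs =>
      intro x
      by_cases h : x = x * s
      · rw [← h]
      · exact SimpleGraph.Adj.reachable ((SimpleGraph.mulCayley_adj' S _ _).2 ⟨h, s, hs, Or.inl rfl⟩)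
    | one => intro x; simp
    | mul s t _ _ hs ht => intro x; rw [← mul_assoc]; exact (hs x).trans (ht _)
    | inv s _ hs => intro x; simpa using (hs (x * s⁻¹)).symm
  exact { preconnected := fun x y => by simpa using key (x⁻¹ * y) x, nonempty := ⟨1⟩ }

theorem mulCayley_dist_mul_left (hS : Subgroup.closure S = ⊤) (g x y : G) :
    (SimpleGraph.mulCayley S).dist (g * x) (g * y) = (SimpleGraph.mulCayley S).dist x y := by
  have key : ∀ g x y : G, (SimpleGraph.mulCayley S).dist (g * x) (g * y) ≤
      (SimpleGraph.mulCayley S).dist x y := fun g x y => by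
    obtain ⟨p, hp⟩ := (mulCayley_connected hS).exists_walk_length_eq_dist x y
    rw [← hp, ← SimpleGraph.Walk.length_map (cayleyTranslation S g) p]
    exact SimpleGraph.dist_le _
  exact le_antisymm (key g x y) (by simpa using key g⁻¹ (g * x) (g * y))

theorem mulCayley_dist_one_mul (hS : Subgroup.closure S = ⊤) (a x : G) :
    (SimpleGraph.mulCayley S).dist 1 (a * x) = (SimpleGraph.mulCayley S).dist a⁻¹ x := by
  rw [← mulCayley_dist_mul_left hS a a⁻¹ x, mul_inv_cancel]

/-- The sequence `c` is a geodesic of length `n` in the Cayley graph. -/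
structure IsCayleyGeodesic (S : Set G) (c : ℕ → G) (n : ℕ) : Prop where
  adj : ∀ i < n, (SimpleGraph.mulCayley S).Adj (c i) (c (i + 1))
  dist_eq : ∀ i j, i ≤ j → j ≤ n → (SimpleGraph.mulCayley S).dist (c i) (c j) = j - i

theorem exists_isCayleyGeodesic (hS : Subgroup.closure S = ⊤) (x y : G) :
    ∃ c : ℕ → G, c 0 = x ∧ c ((SimpleGraph.mulCayley S).dist x y) = y ∧
      IsCayleyGeodesic S c ((SimpleGraph.mulCayley S).dist x y) := by
  have hconn := mulCayley_connected hS
  obtain ⟨p, hp⟩ := hconn.exists_walk_length_eq_dist x y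
  have hadj : ∀ i < p.length, (SimpleGraph.mulCayley S).Adj (p.getVert i) (p.getVert (i + 1)) :=
    fun i hi => p.adj_getVert_succ hi
  have hle : ∀ i k, i + k ≤ p.length →
      (SimpleGraph.mulCayley S).dist (p.getVert i) (p.getVert (i + k)) ≤ k := fun i k hk => by
    induction k with
    | zero => simp
    | succ k ih =>
      refine (hconn.dist_triangle (v := p.getVert (i + k))).trans (add_le_add (ih (by omega)) ?_)
      exact (SimpleGraph.dist_eq_one_iff_adj.2 (hadj (i + k) (by omega))).le
  refine ⟨p.getVert, p.getVert_zero, by rw [← hp, p.getVert_length], ⟨by rwa [← hp], ?_⟩⟩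
  rw [← hp]
  intro i j hij hj
  have h1 := hle i (j - i) (by omega)
  have h2 := hle 0 i (by omega)
  have h3 := hle j (p.length - j) (by omega)
  rw [Nat.add_sub_cancel' hij] at h1
  rw [Nat.add_sub_cancel' hj, p.getVert_length] at h3
  rw [zero_add, p.getVert_zero] at h2
  have h4 := hconn.dist_triangle (u := x) (v := p.getVert i) (w := y)
  have h5 := hconn.dist_triangle (u := p.getVert i) (v := p.getVert j) (w := y)
  omega

theorem finite_cayleyBall (hS : Subgroup.closure S = ⊤) (hfin : S.Finite) (R : ℕ) :
    {x : G | (SimpleGraph.mulCayley S).dist 1 x ≤ R}.Finite := by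
  induction R with
  | zero =>
    refine (finite_singleton (1 : G)).subset fun x hx => ?_
    have := (mulCayley_connected hS).dist_eq_zero_iff.1 (Nat.le_zero.1 hx)
    exact this.symm
  | succ R ih =>
    refine (ih.union (ih.mul (hfin.union hfin.inv))).subset fun x hx => ?_
    rcases Nat.lt_or_ge ((SimpleGraph.mulCayley S).dist 1 x) (R + 1) with h | h
    · exact Or.inl (Nat.lt_succ_iff.1 h)
    have hx : (SimpleGraph.mulCayley S).dist 1 x = R + 1 := le_antisymm hx h
    obtain ⟨c, h0, h1, hc⟩ := exists_isCayleyGeodesic hS 1 x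
    rw [hx] at h1 hc
    have hadj := hc.adj R (by omega)
    have hd := hc.dist_eq 0 R (by omega) (by omega)
    rw [h0] at hd
    rw [h1, SimpleGraph.mulCayley_adj] at hadj
    refine Or.inr ⟨c R, (hd.trans (Nat.sub_zero R)).le, (c R)⁻¹ * x, ?_, by simp⟩
    refine hadj.2.imp id fun h => ?_
    simpa using h

theorem eventually_dist_one_gt (hS : Subgroup.closure S = ⊤) (hfin : S.Finite) {a : ℕ → G}
    (ha : Function.Injective a) (R : ℕ) : ∀ᶠ n in atTop, R < (SimpleGraph.mulCayley S).dist 1 (a n) := by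
  have := ha.tendsto_cofinite.eventually (finite_cayleyBall hS hfin R).compl_mem_cofinite
  rw [Nat.cofinite_eq_atTop] at this
  exact this.mono fun n hn => not_le.1 hn

end WordMetric

/-! ### The Floyd metric -/

section FloydMetric

variable {G : Type*} [Group G] {S : Set G} {f : ℕ → ℝ≥0}

/-- An element of the group as a point of the Floyd space. -/
def FloydSpace.mk (S : Set G) (f : ℕ → ℝ≥0) (g : G) : FloydSpace S f := g

/-- A bound for the Floyd length of a path that starts outside of the ball of radius `R` and
recedes from the identity. -/
noncomputable def floydTail (f : ℕ → ℝ≥0) (R : ℕ) : ℝ≥0∞ := ∑' k, (f ((k + 2 * R) / 4) : ℝ≥0∞)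

/-- Each `f n` occurs four times in the series of the `f (m / 4)`, which therefore converges;
`floydTail f R` is its tail from the index `2 * R` on. -/
theorem tendsto_floydTail (hf : Summable f) : Tendsto (floydTail f) atTop (𝓝 0) := by
  have h4 : ∑' m, (f (m / 4) : ℝ≥0∞) ≠ ∞ := by
    have e : ∑' m, (f (m / 4) : ℝ≥0∞) = ∑' p : ℕ × Fin 4, (f p.1 : ℝ≥0∞) :=
      ((Nat.divModEquiv 4).tsum_eq fun p => (f p.1 : ℝ≥0∞))
    rw [e, ENNReal.tsum_prod (f := fun a _ => (f a : ℝ≥0∞))]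
    simp only [tsum_fintype, Finset.sum_const, Finset.card_univ, Fintype.card_fin, nsmul_eq_mul]
    rw [ENNReal.tsum_mul_left]
    exact ENNReal.mul_ne_top (by simp) (ENNReal.tsum_coe_ne_top_iff_summable.2 hf)
  have := (ENNReal.tendsto_sum_nat_add (fun m => (f (m / 4) : ℝ≥0∞)) h4).comp
    (tendsto_id.const_mul_atTop' (show 0 < 2 by norm_num))
  exact this

theorem edist_le_of_adj {x y : G} (h : (SimpleGraph.mulCayley S).Adj x y) :
    edist (FloydSpace.mk S f x) (FloydSpace.mk S f y) ≤
      f (min ((SimpleGraph.mulCayley S).dist 1 x) ((SimpleGraph.mulCayley S).dist 1 y)) := by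
  refine iInf_le_of_le (SimpleGraph.Walk.cons h SimpleGraph.Walk.nil) ?_
  change floydLength S f (SimpleGraph.Walk.cons h SimpleGraph.Walk.nil) ≤ _
  simp [floydLength]

theorem edist_le_floydTail (hf : IsFloydFunction f) {b : ℕ → G} {N R : ℕ}
    (hadj : ∀ k < N, (SimpleGraph.mulCayley S).Adj (b k) (b (k + 1)))
    (hb : ∀ k ≤ N, k + 2 * R ≤ 4 * (SimpleGraph.mulCayley S).dist 1 (b k)) :
    edist (FloydSpace.mk S f (b 0)) (FloydSpace.mk S f (b N)) ≤ floydTail f R := by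
  refine (edist_le_range_sum_edist (fun k => FloydSpace.mk S f (b k)) N).trans ?_
  refine le_trans (Finset.sum_le_sum fun k hk => ?_) (ENNReal.sum_le_tsum (Finset.range N))
  rw [Finset.mem_range] at hk
  refine (edist_le_of_adj (hadj k hk)).trans (ENNReal.coe_le_coe.2 ?_)
  refine antitone_nat_of_succ_le hf.antitone ?_
  have h1 := hb k (by omega)
  have h2 := hb (k + 1) (by omega)
  rw [le_min_iff]
  omega

/-- A geodesic which stays outside of a large ball is short in the Floyd metric. -/
theorem IsCayleyGeodesic.edist_le (hS : Subgroup.closure S = ⊤) (hf : IsFloydFunction f)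
    {c : ℕ → G} {n R : ℕ} (hc : IsCayleyGeodesic S c n)
    (hR : ∀ i ≤ n, R ≤ (SimpleGraph.mulCayley S).dist 1 (c i)) :
    edist (FloydSpace.mk S f (c 0)) (FloydSpace.mk S f (c n)) ≤ 2 * floydTail f R := by
  -- The geodesic is cut at a point nearest to the identity, at distance `D ≥ R`. After `k` steps
  -- from there the distance is at least `D` and at least `k - D`, so twice the distance is at least
  -- `k` and at least `2 * R`; the sum is the bound `k + 2 * R ≤ 4 * dist`.
  obtain ⟨i, hi, hmin⟩ := Finset.exists_min_image (Finset.range (n + 1))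
    (fun i => (SimpleGraph.mulCayley S).dist 1 (c i)) ⟨0, by simp⟩
  simp only [Finset.mem_range, Nat.lt_succ_iff] at hi hmin
  have hconn := mulCayley_connected hS
  refine (edist_triangle _ (FloydSpace.mk S f (c i)) _).trans ?_
  rw [two_mul]
  refine add_le_add ?_ ?_
  · rw [edist_comm]
    have := edist_le_floydTail (b := fun k => c (i - k)) (N := i) (R := R) (S := S) hf
      (fun k hk => by
        have := hc.adj (i - (k + 1)) (by omega)
        rw [show i - (k + 1) + 1 = i - k by omega] at this
        exact this.symm)
      (fun k hk => by
        have h1 := hR (i - k) (by omega)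
        have h2 := hmin (i - k) (by omega)
        have h3 := hc.dist_eq (i - k) i (by omega) hi
        have h4 := hconn.dist_triangle (u := c (i - k)) (v := 1) (w := c i)
        rw [SimpleGraph.dist_comm (u := c (i - k)) (v := 1)] at h4
        omega)
    simpa using this
  · have := edist_le_floydTail (b := fun k => c (i + k)) (N := n - i) (R := R) (S := S) hf
      (fun k hk => hc.adj (i + k) (by omega))
      (fun k hk => by
        have h1 := hR (i + k) (by omega)
        have h2 := hmin (i + k) (by omega)
        have h3 := hc.dist_eq i (i + k) (by omega) (by omega)
        have h4 := hconn.dist_triangle (u := c i) (v := 1) (w := c (i + k))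
        rw [SimpleGraph.dist_comm (u := c i) (v := 1)] at h4
        omega)
    simpa [Nat.add_sub_cancel' hi] using this

theorem IsCayleyGeodesic.translate {c : ℕ → G} {n : ℕ} (hS : Subgroup.closure S = ⊤)
    (hc : IsCayleyGeodesic S c n) (a : G) {i : ℕ} (hi : i ≤ n) :
    IsCayleyGeodesic S (fun k => a * c (i + k)) (n - i) where
  adj k hk := SimpleGraph.mulCayley_adj_mul_iff_right.2 (hc.adj (i + k) (by omega))
  dist_eq k l hkl hl := by
    rw [mulCayley_dist_mul_left hS, hc.dist_eq _ _ (by omega) (by omega)]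
    omega

/-- A geodesic from `a⁻¹` to `g` is too long in the Floyd metric to avoid the ball of radius `R`.
From a point in that ball, the rest of the geodesic and a geodesic to the identity both keep
distance at least `R` from `a⁻¹`. Their translates by `a` avoid the ball of radius `R`, so they are
short, and they join `a * g` to `a`. -/
theorem edist_mul_le (hS : Subgroup.closure S = ⊤) (hf : IsFloydFunction f) {R : ℕ} {a g : G}
    (ha : 2 * R ≤ (SimpleGraph.mulCayley S).dist 1 a)
    (hg : 2 * floydTail f R < edist (FloydSpace.mk S f g) (FloydSpace.mk S f a⁻¹)) :
    edist (FloydSpace.mk S f (a * g)) (FloydSpace.mk S f a) ≤ 4 * floydTail f R := by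
  have hconn := mulCayley_connected hS
  obtain ⟨c, h0, h1, hc⟩ := exists_isCayleyGeodesic hS a⁻¹ g
  have ha' : 2 * R ≤ (SimpleGraph.mulCayley S).dist a⁻¹ 1 := by
    rwa [← mulCayley_dist_one_mul hS, mul_one]
  obtain ⟨i, hi, hiR⟩ : ∃ i ≤ (SimpleGraph.mulCayley S).dist a⁻¹ g,
      (SimpleGraph.mulCayley S).dist 1 (c i) < R := by
    by_contra! h
    have := hc.edist_le hS hf h
    rw [h0, h1, edist_comm] at this
    exact absurd hg this.not_gt
  have hd := hconn.dist_triangle (u := a⁻¹) (v := c i) (w := 1)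
  have hdi := hc.dist_eq 0 i (by omega) hi
  rw [SimpleGraph.dist_comm (u := c i)] at hd
  rw [h0] at hdi
  have e1 := (hc.translate hS a hi).edist_le hS hf (R := R) fun k hk => by
    have := hc.dist_eq 0 (i + k) (by omega) (by omega)
    rw [h0] at this
    rw [mulCayley_dist_one_mul hS]
    omega
  obtain ⟨b, hb0, hb1, hb⟩ := exists_isCayleyGeodesic hS (c i) 1
  have e2 := (hb.translate hS a (Nat.zero_le _)).edist_le hS hf (R := R) fun k hk => by
    have h2 := hb.dist_eq k _ (by omega) le_rfl
    rw [hb1] at h2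
    have h3 := hconn.dist_triangle (u := a⁻¹) (v := b k) (w := 1)
    rw [SimpleGraph.dist_comm (u := c i)] at h2
    rw [mulCayley_dist_one_mul hS, zero_add]
    omega
  simp only [add_zero, Nat.add_sub_cancel' hi, h1, zero_add, Nat.sub_zero, hb0, hb1, mul_one] at e1 e2
  refine (edist_triangle _ (FloydSpace.mk S f (a * c i)) _).trans ?_
  rw [edist_comm]
  calc _ ≤ 2 * floydTail f R + 2 * floydTail f R := add_le_add e1 e2
    _ = 4 * floydTail f R := by rw [← add_mul]; norm_num

/-- Translation by `g` increases the distance of an edge from the identity by at most the word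
length of `g`, and likewise decreases it; each unit costs a factor at most `c⁻¹` in Floyd length. -/
theorem exists_mul_edist_le (hS : Subgroup.closure S = ⊤) (hf : IsFloydFunction f) (g : G) :
    ∃ C : ℝ≥0, ∀ x y, edist (FloydSpace.mk S f (g * x)) (FloydSpace.mk S f (g * y)) ≤
      C * edist (FloydSpace.mk S f x) (FloydSpace.mk S f y) := by
  obtain ⟨c, hc, hcf⟩ := hf.ratio
  have hconn := mulCayley_connected hS
  have hcf' : ∀ m k, c ^ k * f m ≤ f (m + k) := fun m k => by
    induction k with
    | zero => simp
    | succ k ih =>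
      calc c ^ (k + 1) * f m = c * (c ^ k * f m) := by ring
        _ ≤ c * f (m + k) := by gcongr
        _ ≤ f (m + (k + 1)) := hcf _
  have hanti := antitone_nat_of_succ_le hf.antitone
  set k := (SimpleGraph.mulCayley S).dist 1 g
  have hdist : ∀ x, (SimpleGraph.mulCayley S).dist 1 x ≤
      (SimpleGraph.mulCayley S).dist 1 (g * x) + k := fun x => by
    have h1 := mulCayley_dist_mul_left hS g 1 x
    rw [mul_one] at h1
    have h2 := hconn.dist_triangle (u := g) (v := 1) (w := g * x)
    rw [SimpleGraph.dist_comm (u := g) (v := 1)] at h2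
    simp only [k]
    omega
  have hC : (c ^ k)⁻¹ ≠ 0 := (inv_pos.2 (pow_pos hc k)).ne'
  refine ⟨(c ^ k)⁻¹, fun x y => ?_⟩
  change (⨅ p, floydLength S f p) ≤ _ * ⨅ p : (SimpleGraph.mulCayley S).Walk x y, floydLength S f p
  rw [ENNReal.mul_iInf_of_ne (by exact_mod_cast hC) ENNReal.coe_ne_top]
  refine le_iInf fun p => iInf_le_of_le (p.map (cayleyTranslation S g)) ?_
  change floydLength S f (p.map (cayleyTranslation S g)) ≤ _
  simp only [floydLength, SimpleGraph.Walk.darts_map, List.map_map]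
  rw [← List.sum_map_mul_left]
  refine List.sum_le_sum fun d _ => ?_
  simp only [Function.comp_apply]
  rw [← ENNReal.coe_mul, ENNReal.coe_le_coe, ← mul_le_mul_iff_right₀ (pow_pos hc k), mul_inv_cancel_left₀ (pow_pos hc k).ne']
  refine (hcf' _ _).trans (hanti ?_)
  have h1 := hdist d.fst
  have h2 := hdist d.snd
  change min _ _ ≤ min ((SimpleGraph.mulCayley S).dist 1 (g * d.fst))
    ((SimpleGraph.mulCayley S).dist 1 (g * d.snd)) + k
  omega

theorem floyd_edist_ne_top (hS : Subgroup.closure S = ⊤) (x y : FloydSpace S f) : edist x y ≠ ∞ := by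
  obtain ⟨p⟩ := (mulCayley_connected hS).preconnected x y
  have h : floydLength S f p ≠ ∞ := by
    unfold floydLength
    induction p.darts with
    | nil => simp
    | cons d l ih => simpa using ih
  exact ne_top_of_le_ne_top h (iInf_le _ p)

/-- A geodesic from the identity to a point outside the ball of radius `R` has Floyd length at most
`floydTail f R` beyond that ball, so finite balls are `ε`-dense. -/
theorem totallyBounded_floydSpace (hS : Subgroup.closure S = ⊤) (hfin : S.Finite)
    (hf : IsFloydFunction f) : TotallyBounded (univ : Set (FloydSpace S f)) := by
  rw [EMetric.totallyBounded_iff]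
  intro ε hε
  obtain ⟨R, hR⟩ := ((tendsto_floydTail hf.summable).eventually_lt_const hε).exists
  refine ⟨{x : G | (SimpleGraph.mulCayley S).dist 1 x ≤ R}, finite_cayleyBall hS hfin R, fun x _ => ?_⟩
  simp only [mem_iUnion]
  rcases le_total ((SimpleGraph.mulCayley S).dist 1 x) R with h | h
  · exact ⟨x, h, by simpa using hε⟩
  · obtain ⟨c, h0, h1, hc⟩ := exists_isCayleyGeodesic hS 1 x
    have hd : ∀ k ≤ (SimpleGraph.mulCayley S).dist 1 x, (SimpleGraph.mulCayley S).dist 1 (c k) = k :=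
      fun k hk => by have := hc.dist_eq 0 k (by omega) hk; rwa [h0, Nat.sub_zero] at this
    refine ⟨c R, (hd R h).le, lt_of_le_of_lt ?_ hR⟩
    have := edist_le_floydTail (b := fun k => c (R + k)) (N := (SimpleGraph.mulCayley S).dist 1 x - R)
      (R := R) (S := S) hf (fun k hk => hc.adj _ (by omega)) (fun k hk => by
        rw [hd _ (by omega)]; omega)
    change edist (FloydSpace.mk S f x) (FloydSpace.mk S f (c R)) ≤ _
    rw [edist_comm]
    simpa [Nat.add_sub_cancel' h, h1] using this

end FloydMetric

/-! ### The Floyd compactification -/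

section FloydCompactification

open UniformSpace (Completion)

variable {G : Type*} [Group G] {S : Set G} {f : ℕ → ℝ≥0}

instance : MulAction G (FloydSpace S f) := inferInstanceAs (MulAction G G)

theorem uniformContinuousConstSMul_floydSpace (hS : Subgroup.closure S = ⊤)
    (hf : IsFloydFunction f) : UniformContinuousConstSMul G (FloydSpace S f) where
  uniformContinuous_const_smul g := by
    obtain ⟨C, hC⟩ := exists_mul_edist_le hS hf g
    exact LipschitzWith.uniformContinuous (K := C) hC

theorem compactSpace_completion_floydSpace (hS : Subgroup.closure S = ⊤) (hfin : S.Finite)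
    (hf : IsFloydFunction f) : CompactSpace (Completion (FloydSpace S f)) := by
  have h1 := (totallyBounded_floydSpace hS hfin hf).image
    (Completion.uniformContinuous_coe (FloydSpace S f))
  rw [image_univ] at h1
  have h2 := h1.closure
  rw [Completion.denseRange_coe.closure_range] at h2
  exact ⟨isCompact_iff_totallyBounded_isComplete.2 ⟨h2, isClosed_univ.isComplete⟩⟩

theorem FloydSpace.smul_mk_one [UniformContinuousConstSMul G (FloydSpace S f)] (g : G) :
    g • ((FloydSpace.mk S f 1 : FloydSpace S f) : Completion (FloydSpace S f)) =
      (FloydSpace.mk S f g : FloydSpace S f) := by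
  rw [← Completion.coe_smul]
  exact congrArg _ (mul_one g)

/-- The group acts on its Floyd compactification with the convergence property. -/
theorem floyd_isBasedConvergence (hS : Subgroup.closure S = ⊤) (hfin : S.Finite)
    (hf : IsFloydFunction f) [UniformContinuousConstSMul G (FloydSpace S f)] :
    IsBasedConvergence G ((FloydSpace.mk S f 1 : FloydSpace S f) : Completion (FloydSpace S f)) := by
  let := PseudoEMetricSpace.toPseudoMetricSpace (floyd_edist_ne_top (f := f) hS)
  intro a x x' y ξ η ha hx hy hξ hη
  simp only [FloydSpace.smul_mk_one] at hξ hη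
  -- The points `x n` of the completion are replaced by group elements that stay close even after
  -- translation by `a n`, so that `edist_mul_le` applies.
  have happrox : ∀ n, ∃ g : G,
      dist (x n) ((FloydSpace.mk S f g : FloydSpace S f) : Completion _) < 1 / ((n : ℝ) + 1) ∧
      dist (a n • x n) ((FloydSpace.mk S f (a n * g) : FloydSpace S f) : Completion _) <
        1 / ((n : ℝ) + 1) := fun n => by
    have hpos : 0 < 1 / ((n : ℝ) + 1) := by positivity
    have hU : {w : Completion (FloydSpace S f) | dist (x n) w < 1 / ((n : ℝ) + 1) ∧
        dist (a n • x n) (a n • w) < 1 / ((n : ℝ) + 1)} ∈ 𝓝 (x n) := by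
      refine IsOpen.mem_nhds ?_ ⟨by simpa using hpos, by simpa using hpos⟩
      exact (isOpen_lt (continuous_const.dist continuous_id) continuous_const).inter
        (isOpen_lt (continuous_const.dist (continuous_const_smul (a n))) continuous_const)
    obtain ⟨_, ⟨g, rfl⟩, h1, h2⟩ := (Completion.denseRange_coe (α := FloydSpace S f)).inter_nhds_nonempty hU
    refine ⟨g, h1, ?_⟩
    rwa [← Completion.coe_smul] at h2
  choose g hg hg' using happrox
  have hgx : Tendsto (fun n => ((FloydSpace.mk S f (g n) : FloydSpace S f) : Completion _)) atTop
      (𝓝 x') := hx.congr_dist (squeeze_zero (fun _ => dist_nonneg) (fun n => (hg n).le)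
        tendsto_one_div_add_atTop_nhds_zero_nat)
  have hgy : Tendsto (fun n => ((FloydSpace.mk S f (a n * g n) : FloydSpace S f) : Completion _))
      atTop (𝓝 y) := hy.congr_dist (squeeze_zero (fun _ => dist_nonneg) (fun n => (hg' n).le)
        tendsto_one_div_add_atTop_nhds_zero_nat)
  by_contra! hne
  have l1 := hgx.dist hη
  have l2 := hgy.dist hξ
  simp only [Completion.dist_eq] at l1 l2
  have p1 := dist_pos.2 hne.1
  have p2 := dist_pos.2 hne.2
  have t4 : Tendsto (fun R => 4 * floydTail f R) atTop (𝓝 0) := by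
    simpa using ENNReal.Tendsto.const_mul (tendsto_floydTail hf.summable) (Or.inr (by simp))
  have t2 : Tendsto (fun R => 2 * floydTail f R) atTop (𝓝 0) := by
    simpa using ENNReal.Tendsto.const_mul (tendsto_floydTail hf.summable) (Or.inr (by simp))
  obtain ⟨R, hR1, hR2⟩ := ((t2.eventually_lt_const (ENNReal.ofReal_pos.2 (half_pos p1))).and
    (t4.eventually_lt_const (ENNReal.ofReal_pos.2 (half_pos p2)))).exists
  obtain ⟨n, h1, h2, h3⟩ := ((l1.eventually_const_lt (half_lt_self p1)).and
    ((l2.eventually_const_lt (half_lt_self p2)).and (eventually_dist_one_gt hS hfin ha (2 * R)))).exists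
  have key := edist_mul_le (f := f) (g := g n) hS hf h3.le (by
    rw [edist_dist]
    exact hR1.trans (ENNReal.ofReal_lt_ofReal_iff_of_nonneg (half_pos p1).le |>.2 h1))
  rw [edist_dist] at key
  have := (key.trans_lt hR2).trans (ENNReal.ofReal_lt_ofReal_iff_of_nonneg (half_pos p2).le |>.2 h2)
  exact lt_irrefl _ this

theorem floydBoundary_subset_basedLimitSet (hS : Subgroup.closure S = ⊤)
    [UniformContinuousConstSMul G (FloydSpace S f)] :
    floydBoundary S f ⊆ basedLimitSet (univ : Set G)
      ((FloydSpace.mk S f 1 : FloydSpace S f) : Completion (FloydSpace S f)) := by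
  let := PseudoEMetricSpace.toPseudoMetricSpace (floyd_edist_ne_top (f := f) hS)
  intro ξ hξ
  obtain ⟨x, hx, hlim⟩ := mem_closure_iff_seq_limit.1
    ((Completion.denseRange_coe (α := FloydSpace S f)) ξ)
  choose g hg using hx
  obtain ⟨σ, hσ, hc⟩ := exists_subseq_const_or_injective g
  have hlim := hlim.comp hσ.tendsto_atTop
  rcases hc with ⟨c, hc⟩ | hc
  · refine absurd ⟨c, tendsto_nhds_unique (tendsto_const_nhds.congr fun n => ?_) hlim⟩ hξ
    simp [← hg, hc]
  · exact ⟨fun n => g (σ n), hc, fun _ => mem_univ _, hlim.congr fun n =>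
      (hg _).symm.trans (FloydSpace.smul_mk_one (S := S) (f := f) (g (σ n))).symm⟩

theorem secondCountableTopology_completion_floydSpace (hS : Subgroup.closure S = ⊤)
    [CompactSpace (Completion (FloydSpace S f))] :
    SecondCountableTopology (Completion (FloydSpace S f)) := by
  let := PseudoEMetricSpace.toPseudoMetricSpace (floyd_edist_ne_top (f := f) hS)
  infer_instance

end FloydCompactification

/-- A group with non-trivial Floyd boundary is a non-elementary convergence group. -/
theorem HasNontrivialFloydBoundary.exists_isBasedConvergence {G : Type u} [Group G]
    (h : HasNontrivialFloydBoundary G) :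
    ∃ (M : Type u) (_ : TopologicalSpace M) (_ : MulAction G M) (o : M),
      CompactSpace M ∧ T2Space M ∧ SecondCountableTopology M ∧ ContinuousConstSMul G M ∧
      IsBasedConvergence G o ∧ (basedLimitSet (univ : Set G) o).Infinite := by
  obtain ⟨S, f, hfin, hS, hf, h3⟩ := h
  have := uniformContinuousConstSMul_floydSpace hS hf
  have := compactSpace_completion_floydSpace hS hfin hf
  have := secondCountableTopology_completion_floydSpace (f := f) hS
  have hb := floyd_isBasedConvergence hS hfin hf
  exact ⟨_, _, _, _, inferInstance, inferInstance, inferInstance, inferInstance, hb,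
    infinite_basedLimitSet hb
      (h3.trans_le (Set.encard_le_encard (floydBoundary_subset_basedLimitSet hS)))⟩

/-! ### Free products -/

section FreeProduct

open Monoid Monoid.CoprodI
open scoped Classical in
/-- The leading syllable of an element of a free product if that syllable is in the factor `i`,
and `1` otherwise. -/
noncomputable def coprodHead {ι : Type*} {G : ι → Type*} [∀ i, Group (G i)] (i : ι)
    (x : CoprodI G) : G i :=
  (Word.equivPair i (Word.equiv x)).head

variable {ι : Type*} {G : ι → Type*} [∀ i, Group (G i)]

theorem coprodHead_of_mul (i : ι) (a : G i) (x : CoprodI G) :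
    coprodHead i (of a * x) = a * coprodHead i x := by
  classical
  have : Word.equiv (of a * x) = (of a : CoprodI G) • Word.equiv x := by
    apply Word.equiv.symm.injective
    rw [Equiv.symm_apply_apply]
    refine Eq.trans ?_ (Word.prod_smul _ _).symm
    exact congrArg _ (Word.equiv.symm_apply_apply x).symm
  unfold coprodHead
  rw [this, Word.equivPair_smul_same]

theorem coprodHead_one (i : ι) : coprodHead i (1 : CoprodI G) = 1 := by
  classical
  have : Word.equiv (1 : CoprodI G) = Word.empty := by
    apply Word.equiv.symm.injective
    rw [Equiv.symm_apply_apply]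
    exact Word.prod_empty.symm
  unfold coprodHead
  rw [this, Word.equivPair_head]
  simp

theorem coprodHead_prod_eq (i : ι) {w w' : Word G} (h : w.toList.head? = w'.toList.head?) :
    coprodHead i w.prod = coprodHead i w'.prod := by
  classical
  have e : ∀ w : Word G, Word.equiv w.prod = w := Word.equiv.apply_symm_apply
  unfold coprodHead
  rw [e, e, Word.equivPair_head, Word.equivPair_head]
  rcases w with ⟨_ | ⟨x, l⟩, h1, h2⟩ <;> rcases w' with ⟨_ | ⟨x', l'⟩, h1', h2'⟩
  · rfl
  · simp at h
  · simp at h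
  · simp only [List.head?_cons, Option.some.injEq] at h
    subst h
    by_cases hi : x.1 = i
    · subst hi; simp
    · simp [hi]

theorem coprodHead_neWord_eq (i : ι) {j k l : ι} {w : NeWord G j k} {w' : NeWord G j l}
    (h : w.head = w'.head) : coprodHead i w.prod = coprodHead i w'.prod := by
  refine coprodHead_prod_eq i ?_
  change w.toList.head? = w'.toList.head?
  simp [h]

theorem coprodHead_neWord_mul_of (i : ι) {j k l : ι} (w : NeWord G j k) (hkl : k ≠ l) (a : G l) :
    coprodHead i (w.prod * of a) = coprodHead i w.prod := by
  by_cases ha : a = 1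
  · simp [ha]
  · rw [← NeWord.prod_singleton a ha, ← NeWord.append_prod (hne := hkl)]
    exact coprodHead_neWord_eq i rfl

/-- Nothing cancels at either junction, so the first syllable of the product is that of `w`. -/
theorem coprodHead_neWord_mul_of_mul (i : ι) {j k l : ι} (w : NeWord G j k) (hkl : k ≠ l) {a : G l}
    (ha : a ≠ 1) {τ : Word G} (hτ : τ.fstIdx ≠ some l) :
    coprodHead i (w.prod * of a * τ.prod) = coprodHead i w.prod := by
  by_cases hτe : τ = Word.empty
  · rw [hτe, Word.prod_empty, mul_one, coprodHead_neWord_mul_of i w hkl]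
  · obtain ⟨p, q, v, rfl⟩ := NeWord.of_word τ hτe
    have hlp : l ≠ p := by
      rw [Word.fstIdx_ne_iff] at hτ
      exact hτ ⟨p, v.head⟩ v.toList_head?
    rw [← NeWord.prod_singleton a ha, ← NeWord.append_prod (hne := hkl)]
    exact (congrArg _ (NeWord.append_prod (hne := hlp)).symm).trans (coprodHead_neWord_eq i rfl)

theorem exists_eq_coprodHead_mul (i : ι) (x : CoprodI G) :
    ∃ τ : Word G, τ.fstIdx ≠ some i ∧ x = of (coprodHead i x) * τ.prod := by
  classical
  refine ⟨(Word.equivPair i (Word.equiv x)).tail, (Word.equivPair i (Word.equiv x)).fstIdx_ne, ?_⟩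
  have h := Word.prod_rcons (Word.equivPair i (Word.equiv x))
  rw [← Word.equivPair_symm, Equiv.symm_apply_apply] at h
  exact (Word.equiv.symm_apply_apply x).symm.trans h

theorem exists_neWord_of_notMem_range (i : ι) {x : CoprodI G}
    (hx : x ∉ (of : G i →* CoprodI G).range) :
    ∃ (j k : ι) (w : NeWord G j k), j ≠ i ∧ x = of (coprodHead i x) * w.prod := by
  obtain ⟨τ, hτ, h⟩ := exists_eq_coprodHead_mul i x
  by_cases hτe : τ = Word.empty
  · rw [hτe, Word.prod_empty, mul_one] at h
    exact absurd ⟨_, h.symm⟩ hx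
  · obtain ⟨j, k, v, rfl⟩ := NeWord.of_word τ hτe
    refine ⟨j, k, v, ?_, h⟩
    rw [Word.fstIdx_ne_iff] at hτ
    exact (hτ ⟨j, v.head⟩ v.toList_head?).symm

theorem exists_neWord_mul_of (i : ι) {x : CoprodI G} (hx : x ∉ (of : G i →* CoprodI G).range) :
    ∃ (j k : ι) (w : NeWord G j k) (c : G i), k ≠ i ∧ x = w.prod * of c := by
  obtain ⟨j, k, w, hj, h⟩ := exists_neWord_of_notMem_range i (x := x⁻¹) fun h => hx (by simpa using h)
  refine ⟨k, j, w.inv, (coprodHead i x⁻¹)⁻¹, hj, ?_⟩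
  rw [NeWord.inv_prod, map_inv, ← mul_inv_rev, ← h, inv_inv]

/-- Outside the factor `l`, right multiplication by that factor affects only a last syllable that is
not the first. -/
theorem coprodHead_mul_of_of_notMem (i l : ι) {x : CoprodI G}
    (hx : x ∉ (of : G l →* CoprodI G).range) (a : G l) :
    coprodHead i (x * of a) = coprodHead i x := by
  obtain ⟨j, k, w, c, hk, rfl⟩ := exists_neWord_mul_of l hx
  rw [mul_assoc, ← map_mul, coprodHead_neWord_mul_of i w hk, coprodHead_neWord_mul_of i w hk]

theorem coprodHead_mul_of_of_ne {i l : ι} (hil : l ≠ i) (x : CoprodI G) (a : G l) :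
    coprodHead i (x * of a) = coprodHead i x := by
  by_cases hx : x ∈ (of : G l →* CoprodI G).range
  · obtain ⟨c, rfl⟩ := hx
    have key : ∀ c : G l, coprodHead i (of c : CoprodI G) = 1 := fun c => by
      by_cases hc : c = 1
      · rw [hc, map_one, coprodHead_one]
      · classical
        rw [← NeWord.prod_singleton c hc]
        have e : ∀ w : Word G, Word.equiv w.prod = w := Word.equiv.apply_symm_apply
        unfold coprodHead NeWord.prod
        rw [e, Word.equivPair_eq_of_fstIdx_ne]
        simpa [Word.fstIdx, NeWord.toWord] using hil
    rw [← map_mul, key, key]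
  · exact coprodHead_mul_of_of_notMem i l hx a

/-- If the heads `a` of `g` and `b` of `x` differ, cancellation in `g⁻¹ * x` stops at the
non-trivial syllable `a⁻¹ * b`, so that the product starts like `g⁻¹`. -/
theorem coprodHead_dichotomy (i : ι) {g : CoprodI G} (hg : g ∉ (of : G i →* CoprodI G).range)
    (x : CoprodI G) : coprodHead i x = coprodHead i g ∨
      coprodHead i (g⁻¹ * x) = coprodHead i g⁻¹ := by
  rw [or_iff_not_imp_left]
  intro hne
  obtain ⟨j, k, w, hj, h⟩ := exists_neWord_of_notMem_range i hg
  obtain ⟨τ, hτ, h'⟩ := exists_eq_coprodHead_mul i x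
  set a := coprodHead i g
  set b := coprodHead i x
  have e1 : g⁻¹ * x = w.inv.prod * of (a⁻¹ * b) * τ.prod := by
    rw [h, h', NeWord.inv_prod, map_mul, map_inv]; group
  have e2 : g⁻¹ = w.inv.prod * of a⁻¹ := by
    rw [h, NeWord.inv_prod, map_inv]; group
  rw [e1, e2, coprodHead_neWord_mul_of i _ hj, coprodHead_neWord_mul_of_mul i _ hj _ hτ]
  intro hab
  exact hne (inv_mul_eq_one.1 hab).symm

theorem coprodI_closure : Subgroup.closure (⋃ l, range (of : G l →* CoprodI G)) = ⊤ := by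
  rw [eq_top_iff, ← Subgroup.toSubmonoid_le, Subgroup.top_toSubmonoid,
    ← mclosure_iUnion_range_of, Submonoid.closure_le]
  exact Subgroup.subset_closure

/-- A free product acts on a tree of copies of a given space for one of the factors. -/
theorem coprodI_isTreeProjection {M : Type*} [TopologicalSpace M] [CompactSpace M] [T2Space M]
    [SecondCountableTopology M] {i : ι} [MulAction (G i) M] [ContinuousConstSMul (G i) M] {o : M}
    (hG : IsBasedConvergence (G i) o) :
    IsTreeProjection o (of : G i →* CoprodI G) fun x => coprodHead i x • o where
  injective := of_injective i
  map_one := by rw [coprodHead_one, one_smul]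
  map_mul a x := by rw [coprodHead_of_mul, mul_smul]
  dichotomy g hg x := (coprodHead_dichotomy i hg x).imp (fun h => by rw [h]) fun h => by rw [h]
  map_mul_right g hg a := by rw [coprodHead_mul_of_of_notMem i i hg]
  finite := finite_cosets_of_closure (j := (of : G i →* CoprodI G))
    (π := fun x => coprodHead i x • o) coprodI_closure (by
      intro s hs
      obtain ⟨l, a, rfl⟩ := mem_iUnion.1 hs
      refine ⟨{1}, finite_singleton _, fun g hg => ⟨1, rfl, ?_⟩⟩
      by_contra hgr
      refine hg ?_
      by_cases hl : l = i
      · subst hl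
        rw [coprodHead_mul_of_of_notMem l l fun h => hgr (by simpa using h)]
      · rw [coprodHead_mul_of_of_ne hl])
  perspective x := hG.isPerspective_smul_base _

end FreeProduct

/-! ### HNN extensions -/

section HNN

open HNNExtension HNNExtension.NormalWord

variable {G : Type*} [Group G] {A B : Subgroup G} {φ : A ≃* B}

/-- The product of the syllables `t ^ u * g` of a word in an HNN extension. -/
def hnnTail (φ : A ≃* B) (l : List (ℤˣ × G)) : HNNExtension G A B φ :=
  (l.map fun x => (t : HNNExtension G A B φ) ^ (x.1 : ℤ) * of x.2).prod

variable (A B) in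
/-- Words without a subword `t ^ u * g * t ^ (-u)` that could be shortened. -/
def IsHNNReduced (l : List (ℤˣ × G)) : Prop :=
  l.IsChain fun a b => a.2 ∈ toSubgroup A B a.1 → a.1 = b.1

theorem hnnTail_append (l l' : List (ℤˣ × G)) :
    hnnTail φ (l ++ l') = hnnTail φ l * hnnTail φ l' := by
  simp [hnnTail]

theorem hnnTail_cons (x : ℤˣ × G) (l : List (ℤˣ × G)) :
    hnnTail φ (x :: l) = t ^ (x.1 : ℤ) * of x.2 * hnnTail φ l := by
  simp [hnnTail]

@[simp]
theorem hnnTail_nil : hnnTail φ [] = 1 := rfl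

theorem exists_isHNNReduced (x : HNNExtension G A B φ) :
    ∃ (k : G) (l : List (ℤˣ × G)), IsHNNReduced A B l ∧ x = of k * hnnTail φ l := by
  obtain ⟨d⟩ := TransversalPair.nonempty G A B
  exact ⟨_, _, (NormalWord.equiv φ d x).chain, ((NormalWord.equiv φ d).symm_apply_apply x).symm⟩

theorem exists_isHNNReduced_concat {x : HNNExtension G A B φ}
    (hx : x ∉ (of : G →* HNNExtension G A B φ).range) :
    ∃ (k : G) (l : List (ℤˣ × G)) (u : ℤˣ) (c : G), IsHNNReduced A B (l ++ [(u, c)]) ∧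
      x = of k * hnnTail φ (l ++ [(u, c)]) := by
  obtain ⟨k, l, hl, rfl⟩ := exists_isHNNReduced x
  rcases l.eq_nil_or_concat with rfl | ⟨l', ⟨u, c⟩, rfl⟩
  · exact absurd ⟨k, by simp⟩ hx
  · exact ⟨k, l', u, c, by simpa using hl, by simp⟩

theorem isHNNReduced_append {l l' : List (ℤˣ × G)} {u : ℤˣ} {c c' : G}
    (hl : IsHNNReduced A B (l ++ [(u, c)])) (hl' : IsHNNReduced A B l')
    (h : ∀ y ∈ l'.head?, c' ∈ toSubgroup A B u → u = y.1) :
    IsHNNReduced A B (l ++ (u, c') :: l') := by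
  unfold IsHNNReduced at *
  rw [List.isChain_append] at hl ⊢
  refine ⟨hl.1, List.isChain_cons.2 ⟨fun y hy => h y hy, hl'⟩, fun x hx y hy => ?_⟩
  obtain rfl : (u, c') = y := by simpa using hy
  exact hl.2.2 x hx (u, c) (by simp)

/-- A reduced word read backwards is reduced. The projection sees only its beginning, so the rest is
left unspecified. -/
theorem exists_hnnTail_inv (k : G) (l : List (ℤˣ × G)) (u : ℤˣ) (c : G)
    (hl : IsHNNReduced A B (l ++ [(u, c)])) : ∃ (d : G) (l' : List (ℤˣ × G)),
      IsHNNReduced A B ((-u, d) :: l') ∧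
        (of k * hnnTail φ (l ++ [(u, c)]))⁻¹ = of c⁻¹ * hnnTail φ ((-u, d) :: l') := by
  induction l using List.reverseRecOn generalizing u c with
  | nil =>
    refine ⟨k⁻¹, [], List.isChain_singleton _, ?_⟩
    simp [hnnTail_cons, mul_assoc]
  | append_singleton l x ih =>
    obtain ⟨v, b⟩ := x
    have h1 : IsHNNReduced A B (l ++ [(v, b)]) := (List.isChain_append.1 hl).1
    have h2 : b ∈ toSubgroup A B v → v = u :=
      (List.isChain_append.1 hl).2.2 (v, b) (by simp) (u, c) (by simp)
    obtain ⟨d, l', h', e⟩ := ih v b h1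
    refine ⟨b⁻¹, (-v, d) :: l', List.isChain_cons_cons.2 ⟨fun hb => ?_, h'⟩, ?_⟩
    · by_contra hne
      have hvu : v = -u := by
        rw [← Int.units_ne_iff_eq_neg]; rintro rfl; exact hne rfl
      refine hne ?_
      rw [h2 ?_]
      rw [hvu]
      simpa using hb
    · rw [hnnTail_append, ← mul_assoc, mul_inv_rev, e, hnnTail_cons _ ((-v, d) :: l')]
      simp [hnnTail_cons, mul_assoc]

variable {M : Type*} [MulAction G M]

/-- The point of `M` determined by the head and the first stable letter of a word. -/
def hnnPoint (o : M) (m : ℤˣ → M) (k : G) (l : List (ℤˣ × G)) : M :=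
  k • (l.head?.elim o fun x => m (-x.1))

/-- The projection of an HNN extension to a space for the base group. -/
noncomputable def hnnProj (φ : A ≃* B) (o : M) (m : ℤˣ → M) (x : HNNExtension G A B φ) : M :=
  hnnPoint o m (exists_isHNNReduced x).choose (exists_isHNNReduced x).choose_spec.choose

variable {o : M} {m : ℤˣ → M}

/-- By Britton's lemma the stable letters agree, and the heads differ by an element that can be
moved across the first letter `t ^ u`. Such elements form `toSubgroup A B (-u)`, which fixes `m
(-u)`. -/
theorem hnnPoint_eq_of_eq (hm : ∀ u, ∀ a ∈ toSubgroup A B u, a • m u = m u) {k k' : G}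
    {l l' : List (ℤˣ × G)} (hl : IsHNNReduced A B l) (hl' : IsHNNReduced A B l')
    (h : of k * hnnTail φ l = of k' * hnnTail φ l') :
    hnnPoint o m k l = hnnPoint o m k' l' := by
  obtain ⟨h1, h2⟩ := ReducedWord.map_fst_eq_and_of_prod_eq φ (w₁ := ⟨k, l, hl⟩)
    (w₂ := ⟨k', l', hl'⟩) h
  simp only at h1 h2
  rcases l with _ | ⟨x, l⟩
  · obtain rfl : l' = [] := by simpa using h1.symm
    rw [of_injective φ (mul_right_cancel h)]
  · rcases l' with _ | ⟨x', l'⟩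
    · simp at h1
    · have h3 := h2 x.1 (by simp)
      have hx : x.1 = x'.1 := by simp at h1; exact h1.1
      simp only [hnnPoint, List.head?_cons, Option.elim, ← hx]
      nth_rw 1 [← hm _ _ h3]
      rw [← mul_smul, mul_inv_cancel_left]

theorem hnnProj_eq (hm : ∀ u, ∀ a ∈ toSubgroup A B u, a • m u = m u) (k : G)
    {l : List (ℤˣ × G)} (hl : IsHNNReduced A B l) :
    hnnProj φ o m (of k * hnnTail φ l) = hnnPoint o m k l := by
  obtain ⟨hl', h⟩ := (exists_isHNNReduced (of k * hnnTail φ l)).choose_spec.choose_spec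
  exact hnnPoint_eq_of_eq hm hl' hl h.symm

theorem hnnProj_of (hm : ∀ u, ∀ a ∈ toSubgroup A B u, a • m u = m u) (k : G) :
    hnnProj φ o m (of k) = k • o := by
  have := hnnProj_eq (φ := φ) (o := o) hm k (l := []) List.isChain_nil
  rwa [hnnTail_nil, mul_one] at this

theorem hnnProj_of_mul (hm : ∀ u, ∀ a ∈ toSubgroup A B u, a • m u = m u) (a : G)
    (x : HNNExtension G A B φ) : hnnProj φ o m (of a * x) = a • hnnProj φ o m x := by
  obtain ⟨k, l, hl, rfl⟩ := exists_isHNNReduced x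
  rw [← mul_assoc, ← map_mul, hnnProj_eq hm _ hl, hnnProj_eq hm _ hl, hnnPoint, mul_smul]
  rfl

theorem hnnPoint_append (k : G) (l l' : List (ℤˣ × G)) (u : ℤˣ) (c c' : G) :
    hnnPoint o m k (l ++ (u, c') :: l') = hnnPoint o m k (l ++ [(u, c)]) := by
  cases l <;> simp [hnnPoint]

theorem hnnProj_mul_of (hm : ∀ u, ∀ a ∈ toSubgroup A B u, a • m u = m u)
    {x : HNNExtension G A B φ} (hx : x ∉ (of : G →* HNNExtension G A B φ).range) (a : G) :
    hnnProj φ o m (x * of a) = hnnProj φ o m x := by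
  obtain ⟨k, l, u, c, hl, rfl⟩ := exists_isHNNReduced_concat hx
  have h' : IsHNNReduced A B (l ++ [(u, c * a)]) :=
    isHNNReduced_append hl List.isChain_nil (by simp)
  have e : of k * hnnTail φ (l ++ [(u, c)]) * of a = of k * hnnTail φ (l ++ [(u, c * a)]) := by
    simp [hnnTail_append, hnnTail_cons, mul_assoc]
  rw [e, hnnProj_eq hm _ hl, hnnProj_eq hm _ h', hnnPoint_append]

/-- If the reduced words of `g⁻¹` and `x` concatenate to a reduced word, the product starts like
`g⁻¹`. Otherwise the last stable letter of `g⁻¹` cancels against the first of `x`: then `g` and `x`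
leave the base vertex along the same edge of the tree. -/
theorem hnnProj_dichotomy (hm : ∀ u, ∀ a ∈ toSubgroup A B u, a • m u = m u)
    {g : HNNExtension G A B φ} (hg : g ∉ (of : G →* HNNExtension G A B φ).range)
    (x : HNNExtension G A B φ) : hnnProj φ o m x = hnnProj φ o m g ∨
      hnnProj φ o m (g⁻¹ * x) = hnnProj φ o m g⁻¹ := by
  obtain ⟨k, l, u, c, hl, e⟩ := exists_isHNNReduced_concat (x := g⁻¹) (by simpa using hg)
  obtain ⟨h, l₂, hl₂, rfl⟩ := exists_isHNNReduced x
  by_cases hr : ∀ y ∈ l₂.head?, c * h ∈ toSubgroup A B u → u = y.1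
  · right
    have e' : of k * hnnTail φ (l ++ [(u, c)]) * (of h * hnnTail φ l₂) =
        of k * hnnTail φ (l ++ (u, c * h) :: l₂) := by
      simp [hnnTail_append, hnnTail_cons, mul_assoc]
    rw [e, e', hnnProj_eq hm _ hl, hnnProj_eq hm _ (isHNNReduced_append hl hl₂ hr), hnnPoint_append]
  · left
    push Not at hr
    obtain ⟨⟨v, b⟩, hy, hc, hne⟩ := hr
    obtain ⟨d, l', hl', e'⟩ := exists_hnnTail_inv (φ := φ) k l u c hl
    rw [← e, inv_inv] at e'
    rw [e', hnnProj_eq hm _ hl', hnnProj_eq hm _ hl₂]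
    have hv : -v = u := by rw [Int.units_ne_iff_eq_neg.1 hne]
    simp only [hnnPoint, Option.mem_def.1 hy, Option.elim, List.head?_cons, neg_neg, hv]
    rw [eq_inv_smul_iff, ← mul_smul, hm _ _ hc]

/-- Either `t` can be appended to the reduced word or it cancels a last letter `t⁻¹`. As `x * t` is
outside the base group, the first stable letter survives the cancellation. -/
theorem hnnProj_mul_t (hm : ∀ u, ∀ a ∈ toSubgroup A B u, a • m u = m u)
    {x : HNNExtension G A B φ} (hx : x ∉ (of : G →* HNNExtension G A B φ).range)
    (hxt : x * t ∉ (of : G →* HNNExtension G A B φ).range) :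
    hnnProj φ o m (x * t) = hnnProj φ o m x := by
  obtain ⟨k, l, u, c, hl, rfl⟩ := exists_isHNNReduced_concat hx
  by_cases hr : c ∈ toSubgroup A B u → u = 1
  · have e' : of k * hnnTail φ (l ++ [(u, c)]) * t =
        of k * hnnTail φ (l ++ (u, c) :: [(1, 1)]) := by
      simp [hnnTail_append, hnnTail_cons, mul_assoc]
    rw [e', hnnProj_eq hm _ hl, hnnProj_eq hm _ (isHNNReduced_append hl (List.isChain_singleton _)
      (by simpa using hr)), hnnPoint_append]
  · push Not at hr
    obtain ⟨hc, hu⟩ := hr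
    obtain rfl : u = -1 := Int.units_ne_iff_eq_neg.1 hu
    have e : of k * hnnTail φ (l ++ [(-1, c)]) * t =
        of k * hnnTail φ l * of (φ.symm ⟨c, hc⟩ : G) := by
      rw [equiv_symm_eq_conj]
      simp [hnnTail_append, hnnTail_cons, mul_assoc]
    rw [e] at hxt ⊢
    have hl' : IsHNNReduced A B l := (List.isChain_append.1 hl).1
    rw [hnnProj_mul_of hm, hnnProj_eq hm _ hl, hnnProj_eq hm _ hl']
    · rcases l with _ | ⟨y, l⟩
      · simp [← map_mul] at hxt
      · simp [hnnPoint]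
    · exact fun h => hxt (mul_mem h ⟨_, rfl⟩)

variable (φ) in
theorem hnn_closure :
    Subgroup.closure (range (of : G →* HNNExtension G A B φ) ∪ {t}) = ⊤ := by
  rw [eq_top_iff]
  intro x _
  induction x using HNNExtension.induction_on with
  | of g => exact Subgroup.subset_closure (.inl ⟨g, rfl⟩)
  | t => exact Subgroup.subset_closure (.inr rfl)
  | mul x y hx hy => exact mul_mem (hx trivial) (hy trivial)
  | inv x hx => exact inv_mem (hx trivial)

/-- An HNN extension acts on a tree of copies of a given space for the base group. -/
theorem hnn_isTreeProjection [TopologicalSpace M] [CompactSpace M] [T2Space M]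
    [SecondCountableTopology M] [ContinuousConstSMul G M] (hG : IsBasedConvergence G o)
    (hm : ∀ u, ∀ a ∈ toSubgroup A B u, a • m u = m u) (hp : ∀ u, IsPerspective G o (m u)) :
    IsTreeProjection o (of : G →* HNNExtension G A B φ) (hnnProj φ o m) where
  injective := of_injective φ
  map_one := by rw [← map_one of, hnnProj_of hm, one_smul]
  map_mul a x := hnnProj_of_mul hm a x
  dichotomy g hg x := hnnProj_dichotomy hm hg x
  map_mul_right g hg a := hnnProj_mul_of hm hg a
  finite := finite_cosets_of_closure (hnn_closure φ) (by
      rintro _ (⟨a, rfl⟩ | rfl)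
      · refine ⟨{1}, finite_singleton _, fun g hg => ⟨1, rfl, ?_⟩⟩
        by_contra hgr
        exact hg (hnnProj_mul_of hm (fun h => hgr (by simpa using h)) a).symm
      -- In the tree, `1` and `t` belong to adjacent vertices, so only the two vertex spaces there
      -- can separate them.
      · refine ⟨{1, t}, by simp, fun g hg => ?_⟩
        by_contra! hgr
        refine hg (hnnProj_mul_t hm (fun h => hgr 1 (by simp) (by simpa using h)) fun h =>
          hgr t (by simp) ?_).symm
        simpa using inv_mem h)
  perspective x := by
    obtain ⟨k, l, hl, rfl⟩ := exists_isHNNReduced x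
    rw [hnnProj_eq hm _ hl]
    rcases l with _ | ⟨y, l⟩
    · exact hG.isPerspective_smul_base k
    · exact hG.smul_isPerspective (hp _) k

end HNN

/-! ### From based convergence to convergence groups -/

section ConvergenceGroup

variable {G M : Type*} [Group G] [TopologicalSpace M] [CompactSpace M] [T2Space M]
  [SecondCountableTopology M] [MulAction G M] {o : M}

theorem IsBasedConvergence.isCollapsing (hG : IsBasedConvergence G o) {a : ℕ → G} {ξ η : M}
    (ha : Function.Injective a) (hξ : Tendsto (fun n => a n • o) atTop (𝓝 ξ))
    (hη : Tendsto (fun n => (a n)⁻¹ • o) atTop (𝓝 η)) : IsCollapsing a ξ η := by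
  intro K hK hηK U hU
  by_contra hne
  obtain ⟨σ, hσ, hσ'⟩ := extraction_of_frequently_atTop (Filter.not_eventually.1 hne)
  have : ∀ n, ∃ x ∈ K, a (σ n) • x ∉ U := fun n => by
    obtain ⟨_, ⟨x, hx, rfl⟩, hxU⟩ := Set.not_subset.1 (hσ' n)
    exact ⟨x, hx, hxU⟩
  choose x hxK hxU using this
  obtain ⟨x', hx', τ, hτ, hlim⟩ := hK.tendsto_subseq hxK
  obtain ⟨y, ρ, hρ, hy⟩ := CompactSpace.tendsto_subseq fun n => a (σ (τ n)) • x (τ n)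
  have hall := hσ.comp (hτ.comp hρ)
  rcases hG (a ∘ σ ∘ τ ∘ ρ) (x ∘ τ ∘ ρ) x' y ξ η (ha.comp hall.injective)
    (hlim.comp hρ.tendsto_atTop) hy (hξ.comp hall.tendsto_atTop) (hη.comp hall.tendsto_atTop)
    with h | h
  · exact hηK (h ▸ hx')
  · obtain ⟨n, hn⟩ := (hy.eventually (h ▸ hU)).exists
    exact hxU _ hn

theorem IsBasedConvergence.isConvergenceAction (hG : IsBasedConvergence G o) :
    IsConvergenceAction G M := by
  intro γ hγ
  obtain ⟨σ, hσ, ξ, η, hξ, hη⟩ := exists_limits o γ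
  exact ⟨σ, hσ, ξ, η, hG.isCollapsing (hγ.comp hσ.injective) hξ hη⟩

theorem IsBasedConvergence.basedLimitSet_subset (hG : IsBasedConvergence G o) (H : Set G) :
    basedLimitSet H o ⊆ convergenceLimitSet G M := by
  rintro ξ ⟨a, ha, -, hξ⟩
  obtain ⟨η, σ, hσ, hη⟩ := CompactSpace.tendsto_subseq fun n => (a n)⁻¹ • o
  exact ⟨a ∘ σ, ha.comp hσ.injective, η,
    hG.isCollapsing (ha.comp hσ.injective) (hξ.comp hσ.tendsto_atTop) hη⟩

end ConvergenceGroup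

/-- The group `G` acts on a space with the convergence property, in such a way that the elements of
`Z` are parabolic and that the limit set of the subset `H` is infinite. -/
def HasConvergenceAction.{x, y} (G : Type y) [Group G] (H Z : Set G) : Prop :=
  ∃ (M : Type x) (_ : TopologicalSpace M) (_ : MulAction G M) (o : M),
    CompactSpace M ∧ T2Space M ∧ SecondCountableTopology M ∧ ContinuousConstSMul G M ∧
    IsBasedConvergence G o ∧ (basedLimitSet H o).Infinite ∧ ∀ z ∈ Z, ∃ m, HasPowerLimits z o m m

universe w

open BoundedContinuousFunction in
-- Such a space embeds in the space of bounded real sequences, which lives in the lowest universe.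
theorem small_of_secondCountable (M : Type w) [TopologicalSpace M] [T3Space M]
    [SecondCountableTopology M] : Small.{0} M := by
  obtain ⟨f, hf⟩ := TopologicalSpace.exists_embedding_l_infty M
  exact small_of_injective hf.injective

theorem HasConvergenceAction.shrink {G : Type u} [Group G] {H Z : Set G}
    (h : HasConvergenceAction.{w} G H Z) : HasConvergenceAction.{0} G H Z := by
  obtain ⟨M, _, _, o, _, _, _, _, hb, hΛ, hZ⟩ := h
  have := small_of_secondCountable M
  let e := Shrink.homeomorph.{0} M
  have : T2Space (Shrink.{0} M) := e.t2Space
  have he : ∀ (g : G) (x : M), e (g • x) = g • e x := fun g x => equivShrink_smul g x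
  refine ⟨Shrink.{0} M, inferInstance, inferInstance, e o, e.compactSpace, inferInstance,
    e.symm.secondCountableTopology, ⟨fun g => ?_⟩, hb.map e.continuous e.surjective he,
    infinite_basedLimitSet_map hΛ e.continuous he fun x => ?_, fun z hz => ?_⟩
  · have : (fun x : Shrink.{0} M => g • x) = fun x => e (g • e.symm x) := by
      funext x; rw [he, e.apply_symm_apply]
    rw [this]
    fun_prop
  · exact (finite_singleton x).subset fun y hy => e.injective hy
  · obtain ⟨m, hm⟩ := hZ z hz
    exact ⟨e m, hm.map e.continuous he⟩

/-- The action is restricted along `σ`. Since `H` lies in the image, its infinitely many limit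
points survive. -/
theorem HasConvergenceAction.isConvergenceGroup {G Γ : Type*} [Group G] [Group Γ] {H Z : Set G}
    (h : HasConvergenceAction.{w} G H Z) {σ : Γ →* G} (hσ : Function.Injective σ)
    (hH : H ⊆ range σ) : IsConvergenceGroup Γ := by
  obtain ⟨M, _, _, o, _, _, _, _, hb, hΛ, -⟩ := h.shrink
  let := MulAction.compHom M σ
  have hs : ∀ (g : Γ) (x : M), g • x = σ g • x := fun _ _ => rfl
  have hb' : IsBasedConvergence Γ o := by
    intro a x x' y ξ η ha hx hy hξ hη
    exact hb (fun n => σ (a n)) x x' y ξ η (hσ.comp ha) hx hy hξ (by simpa [hs] using hη)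
  refine ⟨M, inferInstance, inferInstance, inferInstance, inferInstance,
    ⟨fun g => continuous_const_smul (σ g)⟩, hb'.isConvergenceAction, ?_⟩
  have hsub : basedLimitSet H o ⊆ basedLimitSet (univ : Set Γ) o := by
    rintro ξ ⟨a, ha, haH, hξ⟩
    choose γ hγ using fun n => hH (haH n)
    refine ⟨γ, fun m n hmn => ha (by rw [← hγ, ← hγ, hmn]), fun _ => mem_univ _, ?_⟩
    simpa [hs, hγ] using hξ
  rw [(hΛ.mono (hsub.trans (hb'.basedLimitSet_subset univ))).encard_eq]
  exact ENat.natCast_lt_top 2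

theorem HasConvergenceAction.map {A Γ M : Type u} [Group A] [Group Γ] [Countable Γ]
    [TopologicalSpace M] [CompactSpace M] [T2Space M] [SecondCountableTopology M] [MulAction A M]
    [ContinuousConstSMul A M] {o : M} {j : A →* Γ} {π : Γ → M} (hb : IsBasedConvergence A o)
    (h : IsTreeProjection o j π) {H Z : Set A} (hΛ : (basedLimitSet H o).Infinite)
    (hZ : ∀ z ∈ Z, ∃ m, HasPowerLimits z o m m) : HasConvergenceAction.{u} Γ (j '' H) (j '' Z) := by
  refine ⟨TreeSpace π, inferInstance, inferInstance, TreeSpace.of π 1, inferInstance, inferInstance,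
    inferInstance, inferInstance, h.isBasedConvergence hb, h.infinite_basedLimitSet hΛ, ?_⟩
  rintro _ ⟨z, hz, rfl⟩
  obtain ⟨m, hm⟩ := hZ z hz
  exact h.hasPowerLimits hm

/-! ### Countability -/

theorem Subgroup.countable_of_closure_eq_top {G : Type*} [Group G] {S : Set G} (hS : S.Countable)
    (h : Subgroup.closure S = ⊤) : Countable G := by
  have := hS.to_subtype
  rw [FreeGroup.closure_eq_range, MonoidHom.range_eq_top] at h
  exact h.countable

theorem Group.FG.countable {G : Type*} [Group G] (h : Group.FG G) : Countable G := by
  obtain ⟨S, hS⟩ := h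
  exact Subgroup.countable_of_closure_eq_top S.countable_toSet hS

/-! ### Iterated HNN extensions -/

theorem HasPowerLimits.smul_of_mem_range {G M : Type*} [Group G] [TopologicalSpace M] [CompactSpace M]
    [T2Space M] [SecondCountableTopology M] [MulAction G M] [ContinuousConstSMul G M] {o c d : M}
    {z : G} (hz : HasPowerLimits z o c d) {a : G} (ha : a ∈ (zpowersHom G z).range) : a • d = d := by
  obtain ⟨k, rfl⟩ := ha
  exact zpow_mem (K := MulAction.stabilizer G d) hz.smul_right k.toAdd

theorem HasConvergenceAction.injective_zpowersHom {G : Type u} [Group G] {H Z : Set G}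
    (hG : HasConvergenceAction.{w} G H Z) {z : G} (hz : z ∈ Z) :
    Function.Injective (zpowersHom G z) := by
  obtain ⟨M, _, _, o, -, -, -, -, -, -, h⟩ := hG
  obtain ⟨m, hm⟩ := h z hz
  exact fun k l hkl => hm.injective hkl

/-- An HNN extension along parabolic cyclic subgroups has a convergence action. -/
theorem HasConvergenceAction.hnnExtension {G : Type u} [Group G] [Countable G] {H Z : Set G}
    (hG : HasConvergenceAction.{u} G H Z) {z z' : G} (hz : z ∈ Z) (hz' : z' ∈ Z)
    (φ : (zpowersHom G z).range ≃* (zpowersHom G z').range) :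
    Countable (HNNExtension G _ _ φ) ∧ HasConvergenceAction.{u} (HNNExtension G _ _ φ)
      ((HNNExtension.of : G →* HNNExtension G _ _ φ) '' H)
      ((HNNExtension.of : G →* HNNExtension G _ _ φ) '' Z) := by
  have : Countable (HNNExtension G _ _ φ) := Subgroup.countable_of_closure_eq_top
    ((countable_range _).union (countable_singleton _)) (hnn_closure φ)
  refine ⟨this, ?_⟩
  obtain ⟨M, _, _, o, _, _, _, _, hb, hΛ, hpar⟩ := hG
  obtain ⟨m, hm⟩ := hpar z hz
  obtain ⟨m', hm'⟩ := hpar z' hz'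
  -- The copies are attached at the parabolic points of `z` and `z'`, which the associated subgroups
  -- fix and which are perspective.
  refine HasConvergenceAction.map hb (hnn_isTreeProjection (m := fun u => if u = 1 then m else m') hb
    (fun u a ha => ?_) fun u => ?_) hΛ hpar
  · rcases Int.units_eq_one_or u with rfl | rfl
    · simpa using hm.smul_of_mem_range ha
    · simpa using hm'.smul_of_mem_range ha
  · split_ifs
    exacts [hm.isPerspective hb, hm'.isPerspective hb]

theorem HasConvergenceAction.exists_hnn {G : Type u} [Group G] [Countable G] {H Z : Set G}
    (hG : HasConvergenceAction.{u} G H Z) {z z' : G} (hz : z ∈ Z) (hz' : z' ∈ Z)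
    {Γ : Type*} [Group Γ] (q : G →* Γ) (τ : Γ) (hτ : τ * q z * τ⁻¹ = q z') :
    ∃ (G' : Type u) (_ : Group G') (ι : G →* G') (s : G') (q' : G' →* Γ), Function.Injective ι ∧
      Countable G' ∧ HasConvergenceAction.{u} G' (ι '' H) (ι '' Z) ∧ s * ι z * s⁻¹ = ι z' ∧
      q'.comp ι = q ∧ q' s = τ := by
  let f := MonoidHom.ofInjective (hG.injective_zpowersHom hz)
  let f' := MonoidHom.ofInjective (hG.injective_zpowersHom hz')
  let φ := f.symm.trans f'
  have hφ : ∀ k : Multiplicative ℤ, φ (f k) = f' k := fun k => by simp [φ]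
  have hf : ∀ k : Multiplicative ℤ, (f k : G) = z ^ k.toAdd := fun k => rfl
  have hf' : ∀ k : Multiplicative ℤ, (f' k : G) = z' ^ k.toAdd := fun k => rfl
  obtain ⟨h1, h2⟩ := hG.hnnExtension hz hz' φ
  refine ⟨HNNExtension G _ _ φ, inferInstance, HNNExtension.of, HNNExtension.t,
    HNNExtension.lift q τ fun a => ?_, HNNExtension.of_injective φ, h1, h2, ?_, ?_, ?_⟩
  · obtain ⟨k, rfl⟩ := f.surjective a
    rw [hφ, hf, hf', map_zpow, map_zpow, ← hτ, conj_zpow]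
    group
  · have h := HNNExtension.equiv_eq_conj (φ := φ) (f (.ofAdd 1))
    rw [hφ, hf, hf'] at h
    simpa using h.symm
  · ext g
    simp
  · simp

/-- One HNN extension is made for each edge. The images of `Z` stay parabolic, so the next extension
is possible, and the map to `Γ` is extended by the universal property. -/
theorem HasConvergenceAction.exists_iterated_hnn {G : Type u} [Group G] [Countable G] {H Z : Set G}
    (hG : HasConvergenceAction.{u} G H Z) {E : Type*} [Finite E] {z z' : E → G}
    (hz : ∀ e, z e ∈ Z) (hz' : ∀ e, z' e ∈ Z) {Γ : Type*} [Group Γ] (q : G →* Γ) (τ : E → Γ)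
    (hτ : ∀ e, τ e * q (z e) * (τ e)⁻¹ = q (z' e)) :
    ∃ (G' : Type u) (_ : Group G') (ι : G →* G') (s : E → G') (q' : G' →* Γ),
      HasConvergenceAction.{u} G' (ι '' H) (ι '' Z) ∧
      (∀ e, s e * ι (z e) * (s e)⁻¹ = ι (z' e)) ∧ q'.comp ι = q ∧ ∀ e, q' (s e) = τ e := by
  classical
  suffices ∀ L : Set E, L.Finite →
      ∃ (G' : Type u) (_ : Group G') (ι : G →* G') (s : E → G') (q' : G' →* Γ), Countable G' ∧
      HasConvergenceAction.{u} G' (ι '' H) (ι '' Z) ∧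
      (∀ e ∈ L, s e * ι (z e) * (s e)⁻¹ = ι (z' e)) ∧ q'.comp ι = q ∧
      ∀ e ∈ L, q' (s e) = τ e by
    obtain ⟨G', _, ι, s, q', -, h1, h2, h3, h4⟩ := this univ finite_univ
    exact ⟨G', _, ι, s, q', h1, fun e => h2 e trivial, h3, fun e => h4 e trivial⟩
  intro L hL
  induction L, hL using Set.Finite.induction_on with
  | empty =>
    exact ⟨G, _, MonoidHom.id G, 1, q, inferInstance, by simpa using hG, by simp, by simp, by simp⟩
  | @insert e L he _ ih =>
    obtain ⟨G₁, _, ι, s, q₁, _, h1, h2, h3, h4⟩ := ih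
    have hq : ∀ g, q₁ (ι g) = q g := fun g => DFunLike.congr_fun h3 g
    obtain ⟨G₂, _, κ, t, q₂, -, hc, k1, k2, k3, k4⟩ := h1.exists_hnn (mem_image_of_mem ι (hz e))
      (mem_image_of_mem ι (hz' e)) q₁ (τ e) (by rw [hq, hq, hτ])
    have hq₂ : ∀ g, q₂ (κ g) = q₁ g := fun g => DFunLike.congr_fun k3 g
    refine ⟨G₂, _, κ.comp ι, fun x => if x = e then t else κ (s x), q₂, hc, ?_, ?_, ?_, ?_⟩
    · rwa [MonoidHom.coe_comp, image_comp, image_comp]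
    · rintro x (rfl | hx)
      · simpa using k2
      · have hxe : x ≠ e := by rintro rfl; exact he hx
        simp only [if_neg hxe, MonoidHom.comp_apply, ← map_mul, ← map_inv, h2 x hx]
    · rw [← MonoidHom.comp_assoc, k3, h3]
    · rintro x (rfl | hx)
      · simpa using k4
      · have hxe : x ≠ e := by rintro rfl; exact he hx
        simp only [if_neg hxe, hq₂, h4 x hx]

/-! ### Potentials on trees -/

/-- A labelling of the darts of a tree by elements of a group is the coboundary of a labelling of
the vertices. -/
theorem SimpleGraph.IsTree.exists_potential {V H : Type*} [Group H] {T : SimpleGraph V}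
    (hT : T.IsTree) (v₀ : V) (a : V → V → H) (ha : ∀ u v, a v u = (a u v)⁻¹) :
    ∃ p : V → H, p v₀ = 1 ∧ ∀ u v, T.Adj u v → p u * a u v = p v := by
  classical
  choose P hP _ using fun v => hT.existsUnique_path v₀ v
  let f : ∀ {u v : V}, T.Walk u v → H := fun w => (w.darts.map fun d => a d.fst d.snd).prod
  have hf : ∀ {u v x : V} (w : T.Walk u v) (h : T.Adj v x), f (w.concat h) = f w * a v x :=
    fun w h => by simp [f, SimpleGraph.Walk.darts_concat]
  refine ⟨fun v => f (P v), ?_, fun u v huv => ?_⟩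
  · have : P v₀ = SimpleGraph.Walk.nil := by
      have := SimpleGraph.Walk.isPath_iff_nil.1 (hP v₀)
      exact this.eq_nil
    simp [f, this]
  -- Of the two paths from `v₀` to the ends of an edge, one extends the other by that edge.
  · by_cases h : u ∈ (P v).support
    · dsimp only
      rw [hT.isAcyclic.path_concat (hP u) (hP v) huv h, hf]
    · have h' := hT.isAcyclic.mem_support_of_ne_mem_support_of_adj_of_isPath (hP u) (hP v) huv h
      dsimp only
      rw [hT.isAcyclic.path_concat (hP v) (hP u) huv.symm h', hf, ha u v, inv_mul_cancel_right]

/-- Without loops and parallel edges in `T`, `b u v * (b v u)⁻¹` is an antisymmetric labelling whose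
value along an edge of `T` is its label, the other factor being `1`. -/
theorem GraphOfGroups.IsMaximalTree.exists_potential {V E H : Type*} [Group H]
    {𝒢 : GraphOfGroups V E} {T : Set E} (hT : 𝒢.IsMaximalTree T) (v₀ : V) (s : E → H) :
    ∃ p : V → H, p v₀ = 1 ∧ ∀ e ∈ T, p (𝒢.src e) * s e = p (𝒢.tgt e) := by
  classical
  obtain ⟨h1, h2, h3⟩ := hT
  let b : V → V → H := fun u v =>
    if h : ∃ e ∈ T, 𝒢.src e = u ∧ 𝒢.tgt e = v then s h.choose else 1
  have hb : ∀ e ∈ T, b (𝒢.src e) (𝒢.tgt e) = s e := fun e he => by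
    have h : ∃ e' ∈ T, 𝒢.src e' = 𝒢.src e ∧ 𝒢.tgt e' = 𝒢.tgt e := ⟨e, he, rfl, rfl⟩
    simp only [b, dif_pos h]
    obtain ⟨k1, k2, k3⟩ := h.choose_spec
    rw [h2 k1 he (by simp only [k2, k3])]
  have hb' : ∀ e ∈ T, b (𝒢.tgt e) (𝒢.src e) = 1 := fun e he => by
    refine dif_neg ?_
    rintro ⟨e', he', k2, k3⟩
    obtain rfl := h2 he' he (by simp only [k2, k3, Sym2.eq_swap])
    exact h1 _ he k2
  obtain ⟨p, hp0, hp⟩ := h3.exists_potential v₀ (fun u v => b u v * (b v u)⁻¹) (by simp)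
  refine ⟨p, hp0, fun e he => ?_⟩
  have := hp (𝒢.src e) (𝒢.tgt e) ((SimpleGraph.fromEdgeSet_adj _).2 ⟨⟨e, he, rfl⟩, h1 e he⟩)
  simpa [hb e he, hb' e he] using this

/-! ### Graphs of groups -/

/-- All of the factor `l` fixes the base point of the tree of spaces for `i`, which thus serves as
the common limit. -/
theorem coprodI_hasPowerLimits_of_ne {ι : Type*} {G : ι → Type*} [∀ i, Group (G i)] {M : Type*}
    [TopologicalSpace M] {i l : ι} (hil : l ≠ i) [MulAction (G i) M] (o : M) {x : G l}
    (hx : Function.Injective fun k : ℤ => x ^ k) :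
    ∃ m, HasPowerLimits (Monoid.CoprodI.of x)
      (TreeSpace.of (fun y : Monoid.CoprodI G => coprodHead i y • o) 1) m m := by
  have key : ∀ c : G l, (Monoid.CoprodI.of c : Monoid.CoprodI G) •
      TreeSpace.of (fun y : Monoid.CoprodI G => coprodHead i y • o) 1 =
        TreeSpace.of (fun y : Monoid.CoprodI G => coprodHead i y • o) 1 := fun c => by
    rw [TreeSpace.smul_of_one]
    refine Subtype.ext (funext fun g => ?_)
    rw [TreeSpace.of_apply, TreeSpace.of_apply, coprodHead_mul_of_of_ne hil, mul_one]
  refine ⟨TreeSpace.of _ 1, fun k k' h => hx (Monoid.CoprodI.of_injective l (by simpa using h)),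
    tendsto_const_nhds.congr fun k => ?_, tendsto_const_nhds.congr fun k => ?_⟩
  · rw [← map_pow, key]
  · rw [← map_pow, ← map_inv, key]

/-- A free product of groups one of which is `G i` has a convergence action with a prescribed finite
set of parabolic elements. -/
theorem HasNontrivialFloydBoundary.hasConvergenceAction_coprodI {ι : Type v} {G : ι → Type w}
    [∀ i, Group (G i)] [Countable (Monoid.CoprodI G)] {i : ι}
    (hi : HasNontrivialFloydBoundary (G i)) {Z : Set (Monoid.CoprodI G)} (hZ : Z.Finite)
    (hZ' : ∀ z ∈ Z, ∃ (l : ι) (x : G l), Monoid.CoprodI.of x = z ∧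
      Function.Injective fun k : ℤ => x ^ k) :
    HasConvergenceAction.{max v w} (Monoid.CoprodI G)
      (range (Monoid.CoprodI.of : G i →* Monoid.CoprodI G)) Z := by
  obtain ⟨M, _, _, o, _, _, _, _, hb, hΛ⟩ := hi.exists_isBasedConvergence
  -- Only the elements of `Z` in the factor `i` have to be pinched.
  obtain ⟨N, _, _, o', _, _, _, _, hb', hΛ', hpar⟩ := exists_parabolic
    (hZ.preimage (Monoid.CoprodI.of_injective i).injOn) (fun x hx => by
      obtain ⟨l, y, hy, hy'⟩ := hZ' _ hx
      refine fun k k' h => hy' (Monoid.CoprodI.of_injective l ?_)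
      simpa [hy] using congrArg (Monoid.CoprodI.of : G i →* Monoid.CoprodI G) h) hb hΛ
  have ht := coprodI_isTreeProjection hb'
  refine ⟨TreeSpace fun y : Monoid.CoprodI G => coprodHead i y • o', inferInstance, inferInstance,
    TreeSpace.of _ 1, inferInstance, inferInstance, inferInstance, inferInstance,
    ht.isBasedConvergence hb', by simpa using ht.infinite_basedLimitSet hΛ', fun z hz => ?_⟩
  obtain ⟨l, x, rfl, hx⟩ := hZ' z hz
  by_cases hl : l = i
  · subst hl
    obtain ⟨m, hm⟩ := hpar x hz
    exact ht.hasPowerLimits hm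
  · exact coprodI_hasPowerLimits_of_ne hl o' hx

theorem GraphOfGroups.exists_embedding {V E : Type*} (𝒢 : GraphOfGroups V E) {T : Set E}
    (hT : 𝒢.IsMaximalTree T) (v₀ : V) {G : Type*} [Group G]
    (j : ∀ v, 𝒢.vertexGroup v →* G) (s : E → G)
    (hs : ∀ e h, s e * j _ (𝒢.tgtHom e h) * (s e)⁻¹ = j _ (𝒢.srcHom e h))
    (q : G →* 𝒢.FundamentalGroup T) (hqj : ∀ v a, q (j v a) = (𝒢.ofVertex v a : 𝒢.FreeProd))
    (hqs : ∀ e, q (s e) = (𝒢.ofEdge e : 𝒢.FreeProd)) :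
    ∃ σ : 𝒢.FundamentalGroup T →* G, Function.Injective σ ∧ range (j v₀) ⊆ range σ := by
  have hqT : ∀ e ∈ T, q (s e) = 1 := fun e he => by
    rw [hqs]
    exact (QuotientGroup.eq_one_iff _).2 (Subgroup.subset_normalClosure (.inr ⟨e, he, rfl⟩))
  classical
  -- The stable letters of `T` lie in the kernel of `q`, so the potential can be taken there.
  -- Conjugation by it kills the relators `t_e = 1` and is invisible to `q`, which makes `q` a left
  -- inverse of `σ`.
  obtain ⟨p, hp0, hp⟩ := hT.exists_potential v₀ fun e =>
    (if he : e ∈ T then ⟨s e, hqT e he⟩ else 1 : q.ker)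
  have hp' : ∀ e ∈ T, (p (𝒢.src e) : G) * s e = p (𝒢.tgt e) := fun e he => by
    simpa [he] using congrArg Subtype.val (hp e he)
  have hqp : ∀ v, q (p v) = 1 := fun v => (p v).2
  let f : 𝒢.FreeProd →* G := Monoid.Coprod.lift
    (Monoid.CoprodI.lift fun v => (MulAut.conj (p v : G)).toMonoidHom.comp (j v))
    (FreeGroup.lift fun e => p (𝒢.src e) * s e * (p (𝒢.tgt e) : G)⁻¹)
  have hfv : ∀ v a, f (𝒢.ofVertex v a) = p v * j v a * (p v : G)⁻¹ := fun v a => by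
    simp [f, ofVertex]
  have hfe : ∀ e, f (𝒢.ofEdge e) = p (𝒢.src e) * s e * (p (𝒢.tgt e) : G)⁻¹ := fun e => by
    simp [f, ofEdge]
  have hf : Subgroup.normalClosure (𝒢.relators T) ≤ f.ker := by
    refine Subgroup.normalClosure_le_normal ?_
    rintro _ (⟨e, h, rfl⟩ | ⟨e, he, rfl⟩)
    · simp only [SetLike.mem_coe, MonoidHom.mem_ker, map_mul, map_inv, hfv, hfe, ← hs]
      group
    · simp only [SetLike.mem_coe, MonoidHom.mem_ker, hfe, hp' e he, mul_inv_cancel]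
  let σ : 𝒢.FundamentalGroup T →* G := QuotientGroup.lift _ f hf
  have hσ : ∀ x : 𝒢.FreeProd, σ x = f x := fun x => rfl
  have hid : (q.comp f) = QuotientGroup.mk' (Subgroup.normalClosure (𝒢.relators T)) := by
    refine Monoid.Coprod.hom_ext (Monoid.CoprodI.ext_hom _ _ fun v => ?_) 
      (FreeGroup.ext_hom _ _ fun e => ?_)
    · ext a
      change q (f (𝒢.ofVertex v a)) = (𝒢.ofVertex v a : 𝒢.FreeProd)
      rw [hfv, map_mul, map_mul, map_inv, hqp, hqj]
      simp
    · change q (f (𝒢.ofEdge e)) = (𝒢.ofEdge e : 𝒢.FreeProd)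
      rw [hfe, map_mul, map_mul, map_inv, hqp, hqp, hqs]
      simp
  refine ⟨σ, Function.LeftInverse.injective (g := q) fun x => ?_, ?_⟩
  · obtain ⟨x, rfl⟩ := QuotientGroup.mk_surjective x
    exact DFunLike.congr_fun hid x
  · rintro _ ⟨a, rfl⟩
    -- The normalisation `p v₀ = 1` leaves the vertex group at `v₀` unconjugated.
    exact ⟨(𝒢.ofVertex v₀ a : 𝒢.FreeProd), by rw [hσ, hfv, hp0]; simp⟩

theorem corollary1p5 {V E : Type*} [Finite V] [Finite E] (𝒢 : GraphOfGroups V E)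
    (hfg : ∀ v, Group.FG (𝒢.vertexGroup v))
    (htf : ∀ v, ∀ g : 𝒢.vertexGroup v, g ≠ 1 → ¬ IsOfFinOrder g)
    (hfloyd : ∀ v, HasNontrivialFloydBoundary (𝒢.vertexGroup v))
    (hcyc : ∀ e, IsCyclic (𝒢.edgeGroup e) ∧ Infinite (𝒢.edgeGroup e))
    (T : Set E) (hT : 𝒢.IsMaximalTree T) :
    IsConvergenceGroup (𝒢.FundamentalGroup T) := by
  obtain ⟨v₀⟩ := hT.2.2.connected.nonempty
  have := fun v => (hfg v).countable
  have : Countable (Monoid.CoprodI 𝒢.vertexGroup) := Subgroup.countable_of_closure_eq_top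
    (countable_iUnion fun v => countable_range _) coprodI_closure
  choose z hz using fun e => (hcyc e).1.exists_generator
  have hz1 : ∀ e, z e ≠ 1 := fun e h => by
    have := (hcyc e).2
    obtain ⟨x, hx⟩ := exists_ne (1 : 𝒢.edgeGroup e)
    have := hz e x
    rw [h, Subgroup.zpowers_one_eq_bot] at this
    exact hx this
  let a : E → Monoid.CoprodI 𝒢.vertexGroup := fun e => Monoid.CoprodI.of (𝒢.srcHom e (z e))
  let b : E → Monoid.CoprodI 𝒢.vertexGroup := fun e => Monoid.CoprodI.of (𝒢.tgtHom e (z e))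
  have hinf : ∀ (v : V) (g : 𝒢.vertexGroup v), g ≠ 1 → Function.Injective fun k : ℤ => g ^ k :=
    fun v g hg => injective_zpow_iff_not_isOfFinOrder.2 (htf v g hg)
  have hbase := (hfloyd v₀).hasConvergenceAction_coprodI (Z := range a ∪ range b)
    ((finite_range a).union (finite_range b)) (by
      rintro _ (⟨e, rfl⟩ | ⟨e, rfl⟩)
      · exact ⟨_, _, rfl, hinf _ _ ((map_ne_one_iff _ (𝒢.srcHom_injective e)).2 (hz1 e))⟩
      · exact ⟨_, _, rfl, hinf _ _ ((map_ne_one_iff _ (𝒢.tgtHom_injective e)).2 (hz1 e))⟩)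
  let q₀ : Monoid.CoprodI 𝒢.vertexGroup →* 𝒢.FundamentalGroup T :=
    (QuotientGroup.mk' _).comp Monoid.Coprod.inl
  obtain ⟨G, _, ι, s, q, hG, hs, hq, hqs⟩ := hbase.exists_iterated_hnn (z := b) (z' := a)
    (fun e => .inr ⟨e, rfl⟩) (fun e => .inl ⟨e, rfl⟩) q₀
    (fun e => ((𝒢.ofEdge e : 𝒢.FreeProd) : 𝒢.FundamentalGroup T)) fun e => by
      rw [← mul_inv_eq_one]
      exact (QuotientGroup.eq_one_iff _).2
        (Subgroup.subset_normalClosure (.inl ⟨e, z e, rfl⟩))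
  obtain ⟨σ, hσ, hσ'⟩ := 𝒢.exists_embedding hT v₀ (fun v => ι.comp Monoid.CoprodI.of) s (fun e h => by
      -- The edge group is cyclic, so the relation for its generator implies all others.
      obtain ⟨k, rfl⟩ := hz e h
      simp only [map_zpow, ← conj_zpow]
      exact congrArg (· ^ k) (hs e)) q (fun v x => DFunLike.congr_fun hq (Monoid.CoprodI.of x)) hqs
  refine hG.isConvergenceGroup hσ ?_
  rwa [← range_comp]
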